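/- Unit squares are closed axis-parallel squares of side length $1$ in the plane. An instance of Unique Square Set Cover consists of a finite set $P$ of $n$ points in $\mathbb{R}^2$ and a finite set $D$ of $m$ unit squares. A feasible solution is a subset $S\subseteq D$ such that every point of $P$ lies in at least one square of $S$. An optimal solution is a feasible solution that maximizes the number of points of $P$ lying in exactly one square of $S$. The model of computation is the real RAM: natural-number and real variables and arrays; unit-cost addition, subtraction and comparison of natural numbers; unit-cost arithmetic and comparison of real numbers; no rounding of reals to integers. The input consists of $n$, $m$, the coordinates of the points and the coordinates of the lower-left corners of the squares. Theorem. There is an absolute constant $C$ such that for every real $k\ge 1$ there are an algorithm and a constant $A_k$ with the following property. On every instance in which all points of $P$ lie in some axis-parallel $k\times k$ square, the algorithm halts after at most $A_k\cdot \max(n,1)\cdot \max(m,1)^{Ck^2}$ steps; it outputs an optimal solution if a feasible solution exists, and otherwise reports that there is none. In particular, for constant $k$ an optimal solution is computed in $O(n\cdot m^{O(k^2)})$ time. -/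

import Mathlib

namespace UniqueSquareCover

/-! ### The problem -/

/-- The closed axis-parallel unit square with lower-left corner `c`
(`ℝ × ℝ` carries the coordinatewise order). -/
def unitSquare (c : ℝ × ℝ) : Set (ℝ × ℝ) :=
  Set.Icc c (c + (1, 1))

/-- `S` is a sub-collection of `D` that covers every point of `P`. Collections of unit squares are
given by the sets of their lower-left corners. -/
def IsCover (P D S : Finset (ℝ × ℝ)) : Prop :=
  S ⊆ D ∧ ∀ q ∈ P, ∃ c ∈ S, q ∈ unitSquare c

open Classical in
/-- The number of points of `P` that lie in exactly one square of `S`. -/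
noncomputable def uniqueCount (P S : Finset (ℝ × ℝ)) : ℕ :=
  (P.filter fun q => ∃! c, c ∈ S ∧ q ∈ unitSquare c).card

/-- `S` is an optimal solution of the instance `(P, D)`. -/
def IsOptimal (P D S : Finset (ℝ × ℝ)) : Prop :=
  IsCover P D S ∧ ∀ S', IsCover P D S' → uniqueCount P S' ≤ uniqueCount P S

/-! ### The machine model: a real RAM, programmed by while-programs

The memory has natural-number and real variables and arrays, whose names are natural numbers; a
program mentions only finitely many names, while array indices are computed at run time. Natural
numbers can be added, subtracted (truncated at `0`) and compared, but not multiplied; real numbers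
admit the four arithmetic operations and comparisons. There is no rounding and no other way to turn
a real into a natural number. Every operation, memory access, constant and test has unit cost. -/

structure State where
  natVar : ℕ → ℕ
  natArr : ℕ → ℕ → ℕ
  realVar : ℕ → ℝ
  realArr : ℕ → ℕ → ℝ

inductive NatExpr where
  | const (c : ℕ)
  | var (x : ℕ)
  | get (a : ℕ) (i : NatExpr)
  | add (e f : NatExpr)
  | sub (e f : NatExpr)

inductive RealExpr where
  | const (c : ℤ)
  | var (x : ℕ)
  | get (a : ℕ) (i : NatExpr)
  | add (e f : RealExpr)
  | sub (e f : RealExpr)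
  | mul (e f : RealExpr)
  | div (e f : RealExpr)

inductive BoolExpr where
  | natLe (e f : NatExpr)
  | realLe (e f : RealExpr)
  | not (b : BoolExpr)
  | and (b c : BoolExpr)

namespace NatExpr

def eval (σ : State) : NatExpr → ℕ
  | const c => c
  | var x => σ.natVar x
  | get a i => σ.natArr a (eval σ i)
  | add e f => eval σ e + eval σ f
  | sub e f => eval σ e - eval σ f

def cost : NatExpr → ℕ
  | const _ => 1
  | var _ => 1
  | get _ i => 1 + cost i
  | add e f => 1 + cost e + cost f
  | sub e f => 1 + cost e + cost f

end NatExpr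

namespace RealExpr

noncomputable def eval (σ : State) : RealExpr → ℝ
  | const c => c
  | var x => σ.realVar x
  | get a i => σ.realArr a (i.eval σ)
  | add e f => eval σ e + eval σ f
  | sub e f => eval σ e - eval σ f
  | mul e f => eval σ e * eval σ f
  | div e f => eval σ e / eval σ f

def cost : RealExpr → ℕ
  | const _ => 1
  | var _ => 1
  | get _ i => 1 + i.cost
  | add e f => 1 + cost e + cost f
  | sub e f => 1 + cost e + cost f
  | mul e f => 1 + cost e + cost f
  | div e f => 1 + cost e + cost f

end RealExpr

namespace BoolExpr

/-- `b.Holds σ`: the test `b` succeeds in the state `σ`. -/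
def Holds (σ : State) : BoolExpr → Prop
  | natLe e f => e.eval σ ≤ f.eval σ
  | realLe e f => e.eval σ ≤ f.eval σ
  | not b => ¬ Holds σ b
  | and b c => Holds σ b ∧ Holds σ c

def cost : BoolExpr → ℕ
  | natLe e f => 1 + e.cost + f.cost
  | realLe e f => 1 + e.cost + f.cost
  | not b => 1 + cost b
  | and b c => 1 + cost b + cost c

end BoolExpr

inductive Program where
  | skip
  | setNat (x : ℕ) (e : NatExpr)
  | putNat (a : ℕ) (i e : NatExpr)
  | setReal (x : ℕ) (e : RealExpr)
  | putReal (a : ℕ) (i : NatExpr) (e : RealExpr)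
  | seq (p q : Program)
  | cond (b : BoolExpr) (p q : Program)
  | loop (b : BoolExpr) (p : Program)

namespace State

def setNat (σ : State) (x v : ℕ) : State :=
  { σ with natVar := Function.update σ.natVar x v }

def putNat (σ : State) (a i v : ℕ) : State :=
  { σ with natArr := Function.update σ.natArr a (Function.update (σ.natArr a) i v) }

def setReal (σ : State) (x : ℕ) (v : ℝ) : State :=
  { σ with realVar := Function.update σ.realVar x v }

def putReal (σ : State) (a i : ℕ) (v : ℝ) : State :=
  { σ with realArr := Function.update σ.realArr a (Function.update (σ.realArr a) i v) }

end State

/-- `Runs p σ τ t`: started in the state `σ`, the program `p` halts in the state `τ` after exactly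
`t` steps. -/
inductive Runs : Program → State → State → ℕ → Prop where
  | skip (σ : State) : Runs .skip σ σ 1
  | setNat (x : ℕ) (e : NatExpr) (σ : State) :
      Runs (.setNat x e) σ (σ.setNat x (e.eval σ)) (1 + e.cost)
  | putNat (a : ℕ) (i e : NatExpr) (σ : State) :
      Runs (.putNat a i e) σ (σ.putNat a (i.eval σ) (e.eval σ)) (1 + i.cost + e.cost)
  | setReal (x : ℕ) (e : RealExpr) (σ : State) :
      Runs (.setReal x e) σ (σ.setReal x (e.eval σ)) (1 + e.cost)
  | putReal (a : ℕ) (i : NatExpr) (e : RealExpr) (σ : State) :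
      Runs (.putReal a i e) σ (σ.putReal a (i.eval σ) (e.eval σ)) (1 + i.cost + e.cost)
  | seq {p q : Program} {σ τ υ : State} {t u : ℕ} :
      Runs p σ τ t → Runs q τ υ u → Runs (.seq p q) σ υ (t + u)
  | condTrue {b : BoolExpr} {p q : Program} {σ τ : State} {t : ℕ} :
      b.Holds σ → Runs p σ τ t → Runs (.cond b p q) σ τ (1 + b.cost + t)
  | condFalse {b : BoolExpr} {p q : Program} {σ τ : State} {t : ℕ} :
      ¬ b.Holds σ → Runs q σ τ t → Runs (.cond b p q) σ τ (1 + b.cost + t)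
  | loopTrue {b : BoolExpr} {p : Program} {σ τ υ : State} {t u : ℕ} :
      b.Holds σ → Runs p σ τ t → Runs (.loop b p) τ υ u →
      Runs (.loop b p) σ υ (1 + b.cost + t + u)
  | loopFalse {b : BoolExpr} {p : Program} {σ : State} :
      ¬ b.Holds σ → Runs (.loop b p) σ σ (1 + b.cost)

/-- The model is deterministic: final state and number of steps depend only on program and input. -/
theorem Runs.unique {p : Program} {σ τ τ' : State} {t t' : ℕ}
    (h : Runs p σ τ t) (h' : Runs p σ τ' t') : τ = τ' ∧ t = t' := by
  induction h generalizing τ' t' with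
  | skip | setNat | putNat | setReal | putReal => cases h'; exact ⟨rfl, rfl⟩
  | seq _ _ ih₁ ih₂ =>
    cases h' with
    | seq g₁ g₂ =>
      obtain ⟨rfl, rfl⟩ := ih₁ g₁
      obtain ⟨rfl, rfl⟩ := ih₂ g₂
      exact ⟨rfl, rfl⟩
  | condTrue hb _ ih =>
    cases h' with
    | condTrue _ g => obtain ⟨rfl, rfl⟩ := ih g; exact ⟨rfl, rfl⟩
    | condFalse hn _ => exact absurd hb hn
  | condFalse hb _ ih =>
    cases h' with
    | condTrue hn _ => exact absurd hn hb
    | condFalse _ g => obtain ⟨rfl, rfl⟩ := ih g; exact ⟨rfl, rfl⟩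
  | loopTrue hb _ _ ih₁ ih₂ =>
    cases h' with
    | loopTrue _ g₁ g₂ =>
      obtain ⟨rfl, rfl⟩ := ih₁ g₁
      obtain ⟨rfl, rfl⟩ := ih₂ g₂
      exact ⟨rfl, rfl⟩
    | loopFalse hn => exact absurd hb hn
  | loopFalse hb =>
    cases h' with
    | loopTrue hn _ _ => exact absurd hn hb
    | loopFalse _ => exact ⟨rfl, rfl⟩

/-! ### Input and output -/

/-- The array with entries `f 0, …, f (n - 1)`, continued by zeros. -/
def toArray {n : ℕ} (f : Fin n → ℝ) (i : ℕ) : ℝ :=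
  if h : i < n then f ⟨i, h⟩ else 0

/-- The initial state for the points `p 0, …, p (n - 1)` and the unit squares with lower-left
corners `d 0, …, d (m - 1)`: the numbers `n` and `m` are in the natural variables `0` and `1`, the
coordinates of the points in the real arrays `0` and `1`, those of the corners in the real arrays
`2` and `3`, and the rest of the memory is zero. -/
def inputState {n m : ℕ} (p : Fin n → ℝ × ℝ) (d : Fin m → ℝ × ℝ) : State where
  natVar x := if x = 0 then n else if x = 1 then m else 0
  natArr _ _ := 0
  realVar _ := 0
  realArr a :=
    if a = 0 then toArray fun i => (p i).1
    else if a = 1 then toArray fun i => (p i).2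
    else if a = 2 then toArray fun j => (d j).1
    else if a = 3 then toArray fun j => (d j).2
    else fun _ => 0

/-- The final state's answer to whether a cover exists: natural variable `2` is `1` (yes). -/
def State.saysYes (σ : State) : Prop := σ.natVar 2 = 1

/-- The final state's answer to whether a cover exists: natural variable `2` is `0` (no). -/
def State.saysNo (σ : State) : Prop := σ.natVar 2 = 0

/-- The squares selected by the final state: square `j` is selected if entry `j` of the natural
array `0` is `1`. -/
noncomputable def State.selected (σ : State) {m : ℕ} (d : Fin m → ℝ × ℝ) : Finset (ℝ × ℝ) :=
  (Finset.univ.filter fun j : Fin m => σ.natArr 0 j = 1).image d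

end UniqueSquareCover

/-!
Move a comb of vertical lines at distance `1` from each other once over the plane, so that it passes
the points in the order of the fractional parts of their first coordinates. Sort the squares into
`O(k²)` classes by the integer parts of their corners, and consider the moment when the comb passes
a point. Among the squares of one class whose left side the comb has already passed, either all or
none have the first coordinate of the point in their horizontal range, and in the first case the
ones that contain the point are the ones below some height, or the ones above some height. The same
holds for the squares of the class whose left side is still to be passed. Whether the point is
covered `0`, `1` or at least `2` times therefore depends only on the two lowest and the two highest
squares of each class, passed and not passed: on a set of `O(k²)` squares. The sets that a solution
yields at consecutive moments are compatible with each other; conversely, the union of a sequence of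
sets of which consecutive ones are compatible covers each point as often as the set of the moment
when the comb passes the point, up to truncation at `2`. An optimal solution is therefore a longest
path in a layered network whose nodes are pairs of a moment and a set of `O(k²)` squares, of which
there are `m^O(k²)`.
-/

namespace UniqueSquareCover

/-! ### Hoare logic with time bounds -/

/-- A cell is a variable or a whole array of the memory, the unit in which programs are checked
for the memory they leave unchanged. -/
inductive Cell where
  | natVar (x : ℕ)
  | natArr (a : ℕ)
  | realVar (x : ℕ)
  | realArr (a : ℕ)
  deriving DecidableEq

/-- The type of the contents of a cell. -/
@[reducible] def Cell.Content : Cell → Type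
  | natVar _ => ℕ
  | natArr _ => ℕ → ℕ
  | realVar _ => ℝ
  | realArr _ => ℕ → ℝ

/-- The contents of a cell in a given state. -/
def State.get (σ : State) : (c : Cell) → c.Content
  | .natVar x => σ.natVar x
  | .natArr a => σ.natArr a
  | .realVar x => σ.realVar x
  | .realArr a => σ.realArr a

/-- The syntactic check whether `p` contains an assignment to the cell `c`. -/
def Program.assigns (c : Cell) : Program → Bool
  | skip => false
  | setNat x _ => c = .natVar x
  | putNat a _ _ => c = .natArr a
  | setReal x _ => c = .realVar x
  | putReal a _ _ => c = .realArr a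
  | seq p q => p.assigns c || q.assigns c
  | cond _ p q => p.assigns c || q.assigns c
  | loop _ p => p.assigns c

section StateLemmas

variable (σ : State) (x y a b i v : ℕ) (w : ℝ)

@[simp] theorem State.setNat_natVar :
    (σ.setNat x v).natVar y = if y = x then v else σ.natVar y := by
  simp [State.setNat, Function.update_apply]
@[simp] theorem State.setNat_natArr : (σ.setNat x v).natArr = σ.natArr := rfl
@[simp] theorem State.setNat_realVar : (σ.setNat x v).realVar = σ.realVar := rfl
@[simp] theorem State.setNat_realArr : (σ.setNat x v).realArr = σ.realArr := rfl
@[simp] theorem State.putNat_natVar : (σ.putNat a i v).natVar = σ.natVar := rfl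
@[simp] theorem State.putNat_natArr :
    (σ.putNat a i v).natArr b = if b = a then Function.update (σ.natArr a) i v else σ.natArr b := by
  simp [State.putNat, Function.update_apply]
@[simp] theorem State.putNat_realVar : (σ.putNat a i v).realVar = σ.realVar := rfl
@[simp] theorem State.putNat_realArr : (σ.putNat a i v).realArr = σ.realArr := rfl
@[simp] theorem State.setReal_natVar : (σ.setReal x w).natVar = σ.natVar := rfl
@[simp] theorem State.setReal_natArr : (σ.setReal x w).natArr = σ.natArr := rfl
@[simp] theorem State.setReal_realVar :
    (σ.setReal x w).realVar y = if y = x then w else σ.realVar y := by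
  simp [State.setReal, Function.update_apply]
@[simp] theorem State.setReal_realArr : (σ.setReal x w).realArr = σ.realArr := rfl
@[simp] theorem State.putReal_natVar : (σ.putReal a i w).natVar = σ.natVar := rfl
@[simp] theorem State.putReal_natArr : (σ.putReal a i w).natArr = σ.natArr := rfl
@[simp] theorem State.putReal_realVar : (σ.putReal a i w).realVar = σ.realVar := rfl
@[simp] theorem State.putReal_realArr :
    (σ.putReal a i w).realArr b =
      if b = a then Function.update (σ.realArr a) i w else σ.realArr b := by
  simp [State.putReal, Function.update_apply]

end StateLemmas

/-- `σ` and `τ` agree on all cells to which `p` contains no assignment. -/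
def Frame (p : Program) (σ τ : State) : Prop :=
  ∀ c, p.assigns c = false → τ.get c = σ.get c

namespace Frame

variable {p q : Program} {σ τ υ : State}

theorem refl (p : Program) (σ : State) : Frame p σ σ := fun _ _ => rfl

theorem trans (h : Frame p σ τ) (g : Frame p τ υ) : Frame p σ υ :=
  fun c hc => (g c hc).trans (h c hc)

theorem mono (h : Frame p σ τ) (hpq : ∀ c, q.assigns c = false → p.assigns c = false) :
    Frame q σ τ :=
  fun c hc => h c (hpq c hc)

theorem natVar (h : Frame p σ τ) (x : ℕ) (hx : p.assigns (.natVar x) = false) :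
    τ.natVar x = σ.natVar x :=
  h _ hx

theorem natArr (h : Frame p σ τ) (a : ℕ) (ha : p.assigns (.natArr a) = false) :
    τ.natArr a = σ.natArr a :=
  h _ ha

theorem realVar (h : Frame p σ τ) (x : ℕ) (hx : p.assigns (.realVar x) = false) :
    τ.realVar x = σ.realVar x :=
  h _ hx

theorem realArr (h : Frame p σ τ) (a : ℕ) (ha : p.assigns (.realArr a) = false) :
    τ.realArr a = σ.realArr a :=
  h _ ha

theorem setNat {x : ℕ} (h : p.assigns (.natVar x) = true) (v : ℕ) : Frame p σ (σ.setNat x v) := by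
  rintro (y | y | y | y) hy
  · have : y ≠ x := by rintro rfl; simp [h] at hy
    simp [State.get, this]
  all_goals rfl

end Frame

theorem Runs.frame {p : Program} {σ τ : State} {t : ℕ} (h : Runs p σ τ t) : Frame p σ τ := by
  induction h with
  | skip | loopFalse => exact Frame.refl _ _
  | setNat | putNat | setReal | putReal =>
    rintro (c | c | c | c) <;> simp +contextual [Program.assigns, State.get]
  | seq _ _ h₁ h₂ =>
    exact (h₁.mono (by simp +contextual [Program.assigns])).trans
      (h₂.mono (by simp +contextual [Program.assigns]))
  | condTrue _ _ h | condFalse _ _ h => exact h.mono (by simp +contextual [Program.assigns])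
  | loopTrue _ _ _ h₁ h₂ => exact (h₁.mono (by simp [Program.assigns])).trans h₂

/-- Started in `σ`, the program `p` halts within `T` steps in a state satisfying `Q`. -/
def Within (p : Program) (T : ℕ) (σ : State) (Q : State → Prop) : Prop :=
  ∃ τ t, Runs p σ τ t ∧ t ≤ T ∧ Q τ

namespace Within

variable {p q : Program} {T U : ℕ} {σ : State} {Q R : State → Prop}

theorem imp (h : Within p T σ Q) (hTU : T ≤ U) (hQ : ∀ τ, Frame p σ τ → Q τ → R τ) :
    Within p U σ R := by
  obtain ⟨τ, t, hr, ht, hq⟩ := h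
  exact ⟨τ, t, hr, ht.trans hTU, hQ τ hr.frame hq⟩

theorem time_mono (h : Within p T σ Q) (hTU : T ≤ U) : Within p U σ Q :=
  h.imp hTU fun _ _ hq => hq

theorem skip (h : Q σ) : Within .skip 1 σ Q := ⟨_, _, .skip σ, le_rfl, h⟩

theorem setNat {x : ℕ} {e : NatExpr} (h : Q (σ.setNat x (e.eval σ))) :
    Within (.setNat x e) (1 + e.cost) σ Q := ⟨_, _, .setNat x e σ, le_rfl, h⟩

theorem putNat {a : ℕ} {i e : NatExpr} (h : Q (σ.putNat a (i.eval σ) (e.eval σ))) :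
    Within (.putNat a i e) (1 + i.cost + e.cost) σ Q := ⟨_, _, .putNat a i e σ, le_rfl, h⟩

theorem setReal {x : ℕ} {e : RealExpr} (h : Q (σ.setReal x (e.eval σ))) :
    Within (.setReal x e) (1 + e.cost) σ Q := ⟨_, _, .setReal x e σ, le_rfl, h⟩

theorem putReal {a : ℕ} {i : NatExpr} {e : RealExpr}
    (h : Q (σ.putReal a (i.eval σ) (e.eval σ))) :
    Within (.putReal a i e) (1 + i.cost + e.cost) σ Q := ⟨_, _, .putReal a i e σ, le_rfl, h⟩

theorem seq (h : Within p T σ fun τ => Within q U τ Q) : Within (.seq p q) (T + U) σ Q := by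
  obtain ⟨τ, t, hr, ht, υ, u, hu, hut, hq⟩ := h
  exact ⟨υ, t + u, .seq hr hu, by omega, hq⟩

theorem bind (h : Within p T σ Q) (h' : ∀ τ, Frame p σ τ → Q τ → Within q U τ R) :
    Within (.seq p q) (T + U) σ R :=
  seq (h.imp le_rfl h')

theorem cond {b : BoolExpr} (h₁ : b.Holds σ → Within p T σ Q)
    (h₂ : ¬ b.Holds σ → Within q U σ Q) :
    Within (.cond b p q) (1 + b.cost + (T + U)) σ Q := by
  by_cases hb : b.Holds σ
  · obtain ⟨τ, t, hr, ht, hq⟩ := h₁ hb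
    exact ⟨τ, _, .condTrue hb hr, by omega, hq⟩
  · obtain ⟨τ, t, hr, ht, hq⟩ := h₂ hb
    exact ⟨τ, _, .condFalse hb hr, by omega, hq⟩

theorem loop {b : BoolExpr} (Inv : State → Prop) (variant : State → ℕ)
    (hstep : ∀ τ, Inv τ → b.Holds τ → Within p T τ fun υ => Inv υ ∧ variant υ < variant τ)
    (hσ : Inv σ) :
    Within (.loop b p) (variant σ * (1 + b.cost + T) + (1 + b.cost)) σ
      fun τ => Inv τ ∧ ¬ b.Holds τ := by
  induction hv : variant σ using Nat.strong_induction_on generalizing σ with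
  | _ v ih =>
  by_cases hb : b.Holds σ
  · obtain ⟨τ, t, hr, ht, hτ, hlt⟩ := hstep σ hσ hb
    obtain ⟨υ, u, hu, hut, hq⟩ := ih _ (hv ▸ hlt) hτ rfl
    refine ⟨υ, _, .loopTrue hb hr hu, ?_, hq⟩
    have : (variant τ + 1) * (1 + b.cost + T) ≤ v * (1 + b.cost + T) :=
      Nat.mul_le_mul_right _ (by omega)
    rw [Nat.add_one_mul] at this
    omega
  · exact ⟨σ, _, .loopFalse hb, by omega, hσ, hb⟩

end Within

/-- `for x := 0 to e - 1 do p`. -/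
def Program.forLoop (x : ℕ) (e : NatExpr) (p : Program) : Program :=
  .seq (.setNat x (.const 0))
    (.loop (.natLe (.add (.var x) (.const 1)) e)
      (.seq p (.setNat x (.add (.var x) (.const 1)))))

theorem assigns_forLoop (x : ℕ) (e : NatExpr) (p : Program) (c : Cell) :
    (Program.forLoop x e p).assigns c = (p.assigns c || decide (c = .natVar x)) := by
  simp only [Program.forLoop, Program.assigns]
  cases p.assigns c <;> simp

theorem Within.forLoop_body {x : ℕ} (e : NatExpr) {p : Program} {T i : ℕ} {τ : State}
    {Inv : ℕ → State → Prop} (hx : p.assigns (.natVar x) = false) (hi : τ.natVar x = i)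
    (hp : Within p T τ fun υ => Inv (i + 1) (υ.setNat x (i + 1))) :
    Within (.seq p (.setNat x (.add (.var x) (.const 1)))) (T + 4) τ fun υ =>
      Frame (.forLoop x e p) τ υ ∧ υ.natVar x = i + 1 ∧ Inv (i + 1) υ := by
  refine Within.bind hp fun υ hυ hInv => Within.setNat (e := .add (.var x) (.const 1)) ?_
  have hxυ : υ.natVar x = i := (hυ.natVar x hx).trans hi
  simp only [NatExpr.eval, hxυ]
  refine ⟨(hυ.mono ?_).trans (Frame.setNat ?_ _), by simp, hInv⟩ <;>
    simp +contextual [assigns_forLoop]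

/-- The number `b` of iterations enters the time bound only through an upper bound `Y`, so that
the bounds of nested loops are products of powers of a single quantity. -/
theorem Within.forLoop {x : ℕ} {e : NatExpr} {p : Program} {T b Y : ℕ} {σ : State}
    (Inv : ℕ → State → Prop) (hx : p.assigns (.natVar x) = false) (hbY : b ≤ Y) (hY : 1 ≤ Y)
    (he : ∀ τ, Frame (.forLoop x e p) σ τ → e.eval τ = b)
    (h0 : Inv 0 (σ.setNat x 0))
    (hstep : ∀ i τ, i < b → Frame (.forLoop x e p) σ τ → τ.natVar x = i →
      Inv i τ → Within p T τ fun υ => Inv (i + 1) (υ.setNat x (i + 1))) :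
    Within (.forLoop x e p) (Y * (T + 16 + 2 * e.cost)) σ (Inv b) := by
  let J : State → Prop := fun τ => Frame (.forLoop x e p) σ τ ∧
    τ.natVar x ≤ b ∧ Inv (τ.natVar x) τ
  have hloop := Within.loop (p := .seq p (.setNat x (.add (.var x) (.const 1))))
    (b := .natLe (.add (.var x) (.const 1)) e) (T := T + 4) (σ := σ.setNat x 0) J
    (fun τ => b - τ.natVar x) (by
      rintro τ ⟨hFτ, -, hI⟩ hb
      have hlt : τ.natVar x + 1 ≤ b := he τ hFτ ▸ hb
      refine (forLoop_body e hx rfl (hstep _ τ hlt hFτ rfl hI)).imp le_rfl ?_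
      rintro υ - ⟨hFυ, hxυ, hIυ⟩
      exact ⟨⟨hFτ.trans hFυ, hxυ ▸ hlt, hxυ ▸ hIυ⟩, by omega⟩)
    ⟨Frame.setNat (by simp [assigns_forLoop]) _, by simp, by simpa using h0⟩
  simp only [State.setNat_natVar, if_true, Nat.sub_zero, BoolExpr.cost, NatExpr.cost] at hloop
  refine Within.time_mono (Within.seq (Within.setNat (e := .const 0)
    (hloop.imp le_rfl ?_))) ?_
  · rintro τ - ⟨⟨hFτ, hle, hI⟩, hb⟩
    have : ¬ τ.natVar x + 1 ≤ b := he τ hFτ ▸ hb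
    rwa [show τ.natVar x = b by omega] at hI
  · simp only [NatExpr.cost]
    have h1 := Nat.mul_le_mul_right (9 + e.cost + T) hbY
    have h2 : 7 + e.cost ≤ Y * (7 + e.cost) := Nat.le_mul_of_pos_left _ hY
    calc _ = b * (9 + e.cost + T) + (7 + e.cost) := by ring
      _ ≤ Y * (9 + e.cost + T) + Y * (7 + e.cost) := by gcongr
      _ = _ := by ring

/-! ### Depth up to two -/

section Depth

variable {ι α : Type*} {cov : ι → α → Prop} {A B C : Finset ι} {q : α}

open Classical in
/-- The number of members of `S` incident to the point `q`; for squares, `cov j q` says that the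
square `j` contains `q`. -/
noncomputable def depth (cov : ι → α → Prop) (S : Finset ι) (q : α) : ℕ :=
  (S.filter fun j => cov j q).card

theorem depth_mono (h : ∀ j ∈ A, cov j q → j ∈ B) : depth cov A q ≤ depth cov B q := by
  classical
  exact Finset.card_le_card fun j hj => by
    rw [Finset.mem_filter] at hj ⊢
    exact ⟨h j hj.1 hj.2, hj.2⟩

theorem two_le_depth {i j : ι} (hij : i ≠ j) (hi : i ∈ A) (hj : j ∈ A) (hci : cov i q)
    (hcj : cov j q) : 2 ≤ depth cov A q := by
  classical
  exact Finset.one_lt_card.2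
    ⟨i, Finset.mem_filter.2 ⟨hi, hci⟩, j, Finset.mem_filter.2 ⟨hj, hcj⟩, hij⟩

theorem depth_le_depth_inter_iff [DecidableEq ι] :
    depth cov A q ≤ depth cov (A ∩ B) q ↔ ∀ j ∈ A, cov j q → j ∈ B := by
  classical
  refine ⟨fun h j hj hc => ?_,
    fun h => depth_mono fun j hj hc => Finset.mem_inter.2 ⟨hj, h j hj hc⟩⟩
  have heq := Finset.eq_of_subset_of_card_le
    (Finset.filter_subset_filter (fun j => cov j q) (Finset.inter_subset_left (s₂ := B))) h
  have hmem : j ∈ (A ∩ B).filter fun j => cov j q := heq ▸ Finset.mem_filter.2 ⟨hj, hc⟩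
  exact (Finset.mem_inter.1 (Finset.mem_filter.1 hmem).1).2

/-- Replacing `A` by `B` loses no depth at `q` as long as depths are only counted up to two. -/
def Absorbs (cov : ι → α → Prop) (A B : Finset ι) (q : α) : Prop :=
  ∀ j ∈ A, cov j q → j ∈ B ∨ 2 ≤ depth cov B q

theorem absorbs_iff [DecidableEq ι] :
    Absorbs cov A B q ↔ depth cov A q ≤ depth cov (A ∩ B) q ∨ 2 ≤ depth cov B q := by
  rw [depth_le_depth_inter_iff]
  by_cases h : 2 ≤ depth cov B q <;> simp [Absorbs, h]

theorem Absorbs.of_subset (h : A ⊆ B) : Absorbs cov A B q := fun _ hj _ => Or.inl (h hj)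

theorem Absorbs.mono_right (h : Absorbs cov A B q) (hBC : B ⊆ C) : Absorbs cov A C q :=
  fun j hj hc => (h j hj hc).imp (@hBC j) fun h₂ => h₂.trans (depth_mono fun _ hi _ => hBC hi)

theorem Absorbs.min_depth_le (h : Absorbs cov A B q) :
    min (depth cov A q) 2 ≤ min (depth cov B q) 2 := by
  by_cases h₂ : 2 ≤ depth cov B q
  · omega
  · exact min_le_min_right 2 (depth_mono fun j hj hc => (h j hj hc).resolve_right h₂)

theorem Absorbs.trans (hAB : Absorbs cov A B q) (hBC : Absorbs cov B C q) :
    Absorbs cov A C q := by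
  intro j hj hc
  rcases hAB j hj hc with hB | h₂
  · exact hBC j hB hc
  · have := hBC.min_depth_le
    exact Or.inr (by omega)

theorem Absorbs.min_depth_eq (h : Absorbs cov A B q) (hBA : B ⊆ A) :
    min (depth cov A q) 2 = min (depth cov B q) 2 :=
  le_antisymm h.min_depth_le (Absorbs.of_subset hBA).min_depth_le

/-- `A` may be followed by `B` when the sweep arrives at position `r`: what `A` has and `B` lacks
is irrelevant for the points of `P` whose cut is still to come, and conversely for the points whose
cut is past. -/
def Compatible (cov : ι → α → Prop) (cut : α → ℕ) (P : Finset α) (r : ℕ) (A B : Finset ι) : Prop :=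
  ∀ q ∈ P, (r ≤ cut q → Absorbs cov A B q) ∧ (cut q < r → Absorbs cov B A q)

variable {cut : α → ℕ} {P : Finset α} {m : ℕ} {W : ℕ → Finset ι}

theorem absorbs_cut_of_compatible
    (h : ∀ i < m, Compatible cov cut P (i + 1) (W i) (W (i + 1))) (hq : q ∈ P)
    (hcut : cut q ≤ m) {i : ℕ} (hi : i ≤ m) : Absorbs cov (W i) (W (cut q)) q := by
  rcases le_total i (cut q) with hic | hic
  · induction hic using Nat.decreasingInduction with
    | self => exact Absorbs.of_subset subset_rfl
    | of_succ i hlt ih => exact ((h i (by omega) q hq).1 hlt).trans (ih (by omega))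
  · induction i, hic using Nat.le_induction with
    | base => exact Absorbs.of_subset subset_rfl
    | succ i hle ih => exact ((h i (by omega) q hq).2 (by omega)).trans (ih (by omega))

theorem min_depth_biUnion_of_compatible [DecidableEq ι]
    (h : ∀ i < m, Compatible cov cut P (i + 1) (W i) (W (i + 1))) (hq : q ∈ P)
    (hcut : cut q ≤ m) :
    min (depth cov ((Finset.range (m + 1)).biUnion W) q) 2 = min (depth cov (W (cut q)) q) 2 := by
  refine Absorbs.min_depth_eq (fun j hj => ?_)
    (Finset.subset_biUnion_of_mem W (Finset.mem_range_succ_iff.2 hcut))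
  obtain ⟨i, hi, hj⟩ := Finset.mem_biUnion.1 hj
  exact absorbs_cut_of_compatible h hq hcut (Finset.mem_range_succ_iff.1 hi) j hj

end Depth

/-! ### Kernels and windows -/

section Kernel

variable {ι α κ β : Type*} [LinearOrder β] {cov : ι → α → Prop} {cl : ι → κ} {key : ι → β}
  {A B : Finset ι} {j : ι} {q : α}

/-- Within each class of `A`, incidence with `q` is inherited downwards or upwards. -/
def MonotoneOnClasses (cov : ι → α → Prop) (cl : ι → κ) (key : ι → β) (A : Finset ι) (q : α) :
    Prop :=
  ∀ j ∈ A, cov j q → (∀ i ∈ A, cl i = cl j → key i ≤ key j → cov i q) ∨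
    (∀ i ∈ A, cl i = cl j → key j ≤ key i → cov i q)

theorem MonotoneOnClasses.subset (h : MonotoneOnClasses cov cl key A q) (hBA : B ⊆ A) :
    MonotoneOnClasses cov cl key B q :=
  fun j hj hc => (h j (hBA hj) hc).imp (fun h i hi => h i (hBA hi)) fun h i hi => h i (hBA hi)

variable [DecidableEq κ]

/-- The two lowest members of every class of `A`: the members below which there is at most one
further member of the same class. -/
def lowKernel (cl : ι → κ) (key : ι → β) (A : Finset ι) : Finset ι :=
  A.filter fun j => (A.filter fun i => cl i = cl j ∧ key i < key j).card < 2

theorem lowKernel_subset : lowKernel cl key A ⊆ A :=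
  Finset.filter_subset _ _

theorem mem_lowKernel_of_subset (h : B ⊆ A) (hj : j ∈ B) (hk : j ∈ lowKernel cl key A) :
    j ∈ lowKernel cl key B := by
  rw [lowKernel, Finset.mem_filter] at hk ⊢
  exact ⟨hj, (Finset.card_le_card (Finset.filter_subset_filter _ h)).trans_lt hk.2⟩

theorem card_filter_lowKernel_le (hkey : key.Injective) (c : κ) :
    ((lowKernel cl key A).filter fun j => cl j = c).card ≤ 2 := by
  classical
  set F := (lowKernel cl key A).filter fun j => cl j = c
  rcases F.eq_empty_or_nonempty with h | h
  · simp [h]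
  obtain ⟨z, hz, hmax⟩ := F.exists_max_image key h
  obtain ⟨hzk, hzc⟩ := Finset.mem_filter.1 hz
  have hsub : F.erase z ⊆ A.filter fun i => cl i = cl z ∧ key i < key z := by
    intro x hx
    obtain ⟨hxz, hxF⟩ := Finset.mem_erase.1 hx
    obtain ⟨hxk, hxc⟩ := Finset.mem_filter.1 hxF
    exact Finset.mem_filter.2 ⟨lowKernel_subset hxk, hxc.trans hzc.symm,
      (hmax x hxF).lt_of_ne (hkey.ne hxz)⟩
  have hcard := (Finset.card_le_card hsub).trans_lt (Finset.mem_filter.1 hzk).2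
  rw [Finset.card_erase_of_mem hz] at hcard
  omega

theorem card_lowKernel_le (hkey : key.Injective) {C : Finset κ} (hC : ∀ j ∈ A, cl j ∈ C) :
    (lowKernel cl key A).card ≤ 2 * C.card :=
  Finset.card_le_mul_card_image_of_maps_to (fun j hj => hC j (lowKernel_subset hj)) 2
    fun c _ => card_filter_lowKernel_le hkey c

theorem exists_two_lowKernel_lt (hj : j ∈ A) (hjk : j ∉ lowKernel cl key A) :
    ∃ a ∈ lowKernel cl key A, ∃ b ∈ lowKernel cl key A, a ≠ b ∧
      (cl a = cl j ∧ key a < key j) ∧ (cl b = cl j ∧ key b < key j) := by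
  classical
  set B := A.filter fun i => cl i = cl j ∧ key i < key j
  have hcard : 2 ≤ B.card := by
    by_contra h
    exact hjk (Finset.mem_filter.2 ⟨hj, not_le.1 h⟩)
  obtain ⟨a, haB, ha⟩ := B.exists_min_image key (Finset.card_pos.1 (by omega))
  obtain ⟨b, hbB, hb⟩ := (B.erase a).exists_min_image key
    (Finset.card_pos.1 (by rw [Finset.card_erase_of_mem haB]; omega))
  obtain ⟨hba, hbB⟩ := Finset.mem_erase.1 hbB
  obtain ⟨haA, haj⟩ := Finset.mem_filter.1 haB
  obtain ⟨hbA, hbj⟩ := Finset.mem_filter.1 hbB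
  have mem_B {x y : ι} (hx : x ∈ A.filter fun i => cl i = cl y ∧ key i < key y)
      (hy : cl y = cl j ∧ key y < key j) : x ∈ B ∧ key x < key y := by
    obtain ⟨hxA, hxc, hxy⟩ := Finset.mem_filter.1 hx
    exact ⟨Finset.mem_filter.2 ⟨hxA, hxc.trans hy.1, hxy.trans hy.2⟩, hxy⟩
  refine ⟨a, Finset.mem_filter.2 ⟨haA, ?_⟩, b, Finset.mem_filter.2 ⟨hbA, ?_⟩, hba.symm, haj, hbj⟩
  · rw [Finset.card_eq_zero.2 (Finset.eq_empty_of_forall_notMem fun x hx => ?_)]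
    · exact two_pos
    · exact (ha x (mem_B hx haj).1).not_gt (mem_B hx haj).2
  · refine (Finset.card_le_card (t := {a}) fun x hx => ?_).trans_lt
      (by rw [Finset.card_singleton]; exact one_lt_two)
    obtain ⟨hxB, hxb⟩ := mem_B hx hbj
    by_contra hxa
    exact (hb x (Finset.mem_erase.2 ⟨Finset.notMem_singleton.1 hxa, hxB⟩)).not_gt hxb

theorem mem_lowKernel_or_two_le_depth (hj : j ∈ A)
    (h : ∀ i ∈ A, cl i = cl j → key i ≤ key j → cov i q) :
    j ∈ lowKernel cl key A ∨ 2 ≤ depth cov (lowKernel cl key A) q := by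
  refine or_iff_not_imp_left.2 fun hjk => ?_
  obtain ⟨a, ha, b, hb, hab, ⟨hac, haj⟩, hbc, hbj⟩ := exists_two_lowKernel_lt hj hjk
  exact two_le_depth hab ha hb (h a (lowKernel_subset ha) hac haj.le)
    (h b (lowKernel_subset hb) hbc hbj.le)

variable [DecidableEq ι]

/-- The members of `A` that are among the two lowest or the two highest of their class. -/
def kernel (cl : ι → κ) (key : ι → β) (A : Finset ι) : Finset ι :=
  lowKernel cl key A ∪ lowKernel cl (OrderDual.toDual ∘ key) A

theorem kernel_subset : kernel cl key A ⊆ A :=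
  Finset.union_subset lowKernel_subset lowKernel_subset

theorem mem_kernel_of_subset (h : B ⊆ A) (hj : j ∈ B) (hk : j ∈ kernel cl key A) :
    j ∈ kernel cl key B := by
  rw [kernel, Finset.mem_union] at hk ⊢
  exact hk.imp (mem_lowKernel_of_subset h hj) (mem_lowKernel_of_subset h hj)

theorem card_kernel_le (hkey : key.Injective) {C : Finset κ} (hC : ∀ j ∈ A, cl j ∈ C) :
    (kernel cl key A).card ≤ 4 * C.card := by
  calc _ ≤ _ := Finset.card_union_le _ _
    _ ≤ 2 * C.card + 2 * C.card := add_le_add (card_lowKernel_le hkey hC)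
      (card_lowKernel_le (OrderDual.toDual.injective.comp hkey) hC)
    _ = 4 * C.card := by ring

theorem MonotoneOnClasses.absorbs_kernel (h : MonotoneOnClasses cov cl key A q) :
    Absorbs cov A (kernel cl key A) q := by
  intro j hj hc
  rcases h j hj hc with hlow | hhigh
  · exact (mem_lowKernel_or_two_le_depth hj hlow).imp (Finset.mem_union_left _)
      fun h₂ => h₂.trans (depth_mono fun i hi _ => Finset.mem_union_left _ hi)
  · exact (mem_lowKernel_or_two_le_depth (key := OrderDual.toDual ∘ key) hj hhigh).imp
      (Finset.mem_union_right _)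
      fun h₂ => h₂.trans (depth_mono fun i hi _ => Finset.mem_union_right _ hi)

variable {rank : ι → ℕ} {S : Finset ι} {r c : ℕ}

/-- The part of `S` that matters in position `r` of a sweep in which the member `j` of `S` changes
its role when the sweep passes from `rank j` to `rank j + 1`. -/
def window (cl : ι → κ) (key : ι → β) (rank : ι → ℕ) (S : Finset ι) (r : ℕ) :
    Finset ι :=
  kernel cl key (S.filter fun j => rank j < r) ∪ kernel cl key (S.filter fun j => r ≤ rank j)

theorem window_subset : window cl key rank S r ⊆ S :=
  Finset.union_subset (kernel_subset.trans (Finset.filter_subset _ _))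
    (kernel_subset.trans (Finset.filter_subset _ _))

theorem card_window_le (hkey : key.Injective) {C : Finset κ} (hC : ∀ j ∈ S, cl j ∈ C) :
    (window cl key rank S r).card ≤ 8 * C.card := by
  have h (A : Finset ι) (hA : A ⊆ S) : (kernel cl key A).card ≤ 4 * C.card :=
    card_kernel_le hkey fun j hj => hC j (hA hj)
  calc _ ≤ _ := Finset.card_union_le _ _
    _ ≤ 4 * C.card + 4 * C.card :=
      add_le_add (h _ (Finset.filter_subset _ _)) (h _ (Finset.filter_subset _ _))
    _ = 8 * C.card := by ring

theorem mem_window_or_of_lt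
    (h : MonotoneOnClasses cov cl key (S.filter fun j => rank j < c) q) (hrc : r ≤ c) (hj : j ∈ S)
    (hjr : rank j < r) (hc : cov j q) :
    j ∈ window cl key rank S r ∨ 2 ≤ depth cov (window cl key rank S r) q := by
  have hsub : (S.filter fun j => rank j < r) ⊆ S.filter fun j => rank j < c :=
    Finset.monotone_filter_right S fun i _ hi => lt_of_lt_of_le hi hrc
  exact (h.subset hsub).absorbs_kernel.mono_right Finset.subset_union_left j
    (Finset.mem_filter.2 ⟨hj, hjr⟩) hc

theorem mem_window_or_of_le
    (h : MonotoneOnClasses cov cl key (S.filter fun j => c ≤ rank j) q) (hcr : c ≤ r) (hj : j ∈ S)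
    (hjr : r ≤ rank j) (hc : cov j q) :
    j ∈ window cl key rank S r ∨ 2 ≤ depth cov (window cl key rank S r) q := by
  have hsub : (S.filter fun j => r ≤ rank j) ⊆ S.filter fun j => c ≤ rank j :=
    Finset.monotone_filter_right S fun i _ hi => hcr.trans hi
  exact (h.subset hsub).absorbs_kernel.mono_right Finset.subset_union_right j
    (Finset.mem_filter.2 ⟨hj, hjr⟩) hc

theorem mem_window_succ_of_lt (hj : j ∈ window cl key rank S r) (hjr : r < rank j) :
    j ∈ window cl key rank S (r + 1) := by
  have hjF : j ∈ kernel cl key (S.filter fun j => r ≤ rank j) :=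
    (Finset.mem_union.1 hj).resolve_left fun h =>
      (Finset.mem_filter.1 (kernel_subset h)).2.not_ge hjr.le
  refine Finset.mem_union_right _ (mem_kernel_of_subset ?_
    (Finset.mem_filter.2 ⟨window_subset hj, hjr⟩) hjF)
  exact Finset.monotone_filter_right S fun i _ hi => Nat.le_of_succ_le hi

theorem mem_window_of_mem_succ (hj : j ∈ window cl key rank S (r + 1)) (hjr : rank j < r) :
    j ∈ window cl key rank S r := by
  have hjP : j ∈ kernel cl key (S.filter fun j => rank j < r + 1) :=
    (Finset.mem_union.1 hj).resolve_right fun h =>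
      (Finset.mem_filter.1 (kernel_subset h)).2.not_gt (hjr.trans r.lt_succ_self)
  refine Finset.mem_union_left _ (mem_kernel_of_subset ?_
    (Finset.mem_filter.2 ⟨window_subset hj, hjr⟩) hjP)
  exact Finset.monotone_filter_right S fun i _ hi => Nat.lt_succ_of_lt hi

theorem absorbs_window (hpast : MonotoneOnClasses cov cl key (S.filter fun j => rank j < c) q)
    (hfuture : MonotoneOnClasses cov cl key (S.filter fun j => c ≤ rank j) q) :
    Absorbs cov S (window cl key rank S c) q := fun j hj hc =>
  (lt_or_ge (rank j) c).elim (fun hjc => mem_window_or_of_lt hpast le_rfl hj hjc hc)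
    fun hjc => mem_window_or_of_le hfuture le_rfl hj hjc hc

theorem compatible_window {cut : α → ℕ} {P : Finset α}
    (hpast : ∀ q ∈ P, MonotoneOnClasses cov cl key (S.filter fun j => rank j < cut q) q)
    (hfuture : ∀ q ∈ P, MonotoneOnClasses cov cl key (S.filter fun j => cut q ≤ rank j) q) :
    Compatible cov cut P (r + 1) (window cl key rank S r) (window cl key rank S (r + 1)) := by
  refine fun q hq => ⟨fun hr j hj hc => ?_, fun hr j hj hc => ?_⟩
  · rcases le_or_gt (rank j) r with hjr | hjr
    · exact mem_window_or_of_lt (hpast q hq) hr (window_subset hj) (Nat.lt_succ_of_le hjr) hc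
    · exact Or.inl (mem_window_succ_of_lt hj hjr)
  · rcases le_or_gt r (rank j) with hjr | hjr
    · exact mem_window_or_of_le (hfuture q hq) (Nat.le_of_lt_succ hr) (window_subset hj) hjr hc
    · exact Or.inl (mem_window_of_mem_succ hj hjr)

end Kernel

/-! ### Unit intervals modulo one -/

section Floor

variable {R : Type*} [CommRing R] [LinearOrder R] [IsStrictOrderedRing R] [FloorRing R]

/-- Subtract `1` from a number that is at least `1`. -/
def decrease (t : R) : R := if 1 ≤ t then t - 1 else t

/-- The fractional part of `t` for `-(K + 1) ≤ t < K + 1`, computed without rounding. -/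
def offset (K : ℕ) (t : R) : R := decrease^[2 * K + 1] (t + (K + 1 : ℕ))

/-- The position of `t` in the sweep: the comb of vertical lines passes the points of the line in
the order of their fractional parts, and from right to left those with the same fractional part. -/
def sweepKey (K : ℕ) (t : R) : R ×ₗ R := toLex (offset K t, -t)

variable {K : ℕ} {a b c x : R}

theorem iterate_decrease_eq_fract {k : ℕ} (h₀ : 0 ≤ x) (h₁ : x < k + 1) :
    decrease^[k] x = Int.fract x := by
  induction k generalizing x with
  | zero => simpa using (Int.fract_eq_self.2 ⟨h₀, by simpa using h₁⟩).symm
  | succ k ih =>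
    rw [Function.iterate_succ_apply]
    push_cast at h₁
    by_cases h : 1 ≤ x
    · rw [decrease, if_pos h, ih (by linarith) (by linarith), Int.fract_sub_one]
    · have : (0 : R) ≤ k := k.cast_nonneg
      rw [decrease, if_neg h, ih h₀ (by linarith)]

theorem offset_eq_fract (h : x ∈ Set.Ico (-(K + 1) : R) (K + 1)) :
    offset K x = Int.fract x := by
  obtain ⟨h₀, h₁⟩ := h
  rw [offset, iterate_decrease_eq_fract, Int.fract_add_natCast] <;> push_cast <;> linarith

theorem floor_eq_or_eq_add_one (h : x ∈ Set.Icc a (a + 1)) : ⌊x⌋ = ⌊a⌋ ∨ ⌊x⌋ = ⌊a⌋ + 1 := by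
  have h₁ := Int.floor_mono h.1
  have h₂ := Int.floor_mono h.2
  rw [Int.floor_add_one] at h₂
  omega

theorem mem_Icc_of_floor_eq (h : ⌊x⌋ = ⌊c⌋) (hcx : Int.fract c ≤ Int.fract x) :
    x ∈ Set.Icc c (c + 1) := by
  have hc := Int.floor_add_fract c
  have hx := Int.floor_add_fract x
  rw [h] at hx
  constructor <;> linarith [Int.fract_lt_one x, Int.fract_nonneg c]

theorem mem_Icc_of_floor_eq_add_one (h : ⌊x⌋ = ⌊c⌋ + 1) (hxc : Int.fract x ≤ Int.fract c) :
    x ∈ Set.Icc c (c + 1) := by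
  have hc := Int.floor_add_fract c
  have hx := Int.floor_add_fract x
  rw [h, Int.cast_add, Int.cast_one] at hx
  constructor <;> linarith [Int.fract_lt_one c, Int.fract_nonneg x]

theorem mem_Icc_monotone_of_floor_eq (h : x ∈ Set.Icc b (b + 1)) :
    (∀ c, ⌊c⌋ = ⌊b⌋ → c ≤ b → x ∈ Set.Icc c (c + 1)) ∨
      (∀ c, ⌊c⌋ = ⌊b⌋ → b ≤ c → x ∈ Set.Icc c (c + 1)) := by
  rcases floor_eq_or_eq_add_one h with hx | hx
  · refine Or.inl fun c hc hcb => ⟨hcb.trans h.1, ?_⟩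
    have hlt := Int.lt_floor_add_one x
    rw [hx, ← hc] at hlt
    linarith [Int.floor_le c]
  · refine Or.inr fun c hc hbc => ⟨?_, by linarith [h.2]⟩
    have hle := Int.floor_le x
    rw [hx, ← hc, Int.cast_add, Int.cast_one] at hle
    linarith [Int.lt_floor_add_one c]

theorem floor_mem_Icc (h : x ∈ Set.Icc (-(K + 1) : R) K) :
    ⌊x⌋ ∈ Finset.Icc (-(K + 1) : ℤ) K := by
  rw [Finset.mem_Icc, Int.le_floor]
  exact ⟨by simpa using h.1, by simpa using Int.floor_mono h.2⟩

theorem sweepKey_le_sweepKey_iff (ha : a ∈ Set.Ico (-(K + 1) : R) (K + 1))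
    (hx : x ∈ Set.Ico (-(K + 1) : R) (K + 1)) :
    sweepKey K a ≤ sweepKey K x ↔
      Int.fract a < Int.fract x ∨ Int.fract a = Int.fract x ∧ x ≤ a := by
  simp only [sweepKey, Prod.Lex.toLex_le_toLex, offset_eq_fract ha, offset_eq_fract hx,
    neg_le_neg_iff]

theorem sweepKey_le_sweepKey_iff_floor_eq (ha : a ∈ Set.Ico (-(K + 1) : R) (K + 1))
    (hx : x ∈ Set.Ico (-(K + 1) : R) (K + 1)) (h : x ∈ Set.Icc a (a + 1)) :
    sweepKey K a ≤ sweepKey K x ↔ ⌊x⌋ = ⌊a⌋ := by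
  rw [sweepKey_le_sweepKey_iff ha hx]
  have hfa := Int.floor_add_fract a
  have hfx := Int.floor_add_fract x
  constructor
  · rintro (hlt | ⟨-, hxa⟩)
    · refine (floor_eq_or_eq_add_one h).resolve_right fun hx => ?_
      rw [hx, Int.cast_add, Int.cast_one] at hfx
      linarith [h.2]
    · rw [le_antisymm hxa h.1]
  · intro hfl
    rw [hfl] at hfx
    rcases h.1.lt_or_eq with hlt | rfl
    · exact Or.inl (by linarith)
    · exact Or.inr ⟨rfl, le_rfl⟩

theorem fract_le_fract_of_sweepKey_le (ha : a ∈ Set.Ico (-(K + 1) : R) (K + 1))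
    (hx : x ∈ Set.Ico (-(K + 1) : R) (K + 1)) (h : sweepKey K a ≤ sweepKey K x) :
    Int.fract a ≤ Int.fract x :=
  ((sweepKey_le_sweepKey_iff ha hx).1 h).elim le_of_lt fun h => h.1.le

end Floor

/-! ### Instances in the memory of the machine -/

/-- An instance as the machine holds it: the points and squares are numbered, and arrays give the
coordinates of the points and of the lower-left corners of the squares. Entries with an index beyond
the number `n` of points or `m` of squares have no meaning. -/
structure Instance where
  n : ℕ
  m : ℕ
  pointX : ℕ → ℝ
  pointY : ℕ → ℝ
  cornerX : ℕ → ℝ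
  cornerY : ℕ → ℝ

namespace Instance

variable (I : Instance) (K : ℕ)

/-- Square `j` contains point `q`. -/
def Covers (j q : ℕ) : Prop :=
  I.pointX q ∈ Set.Icc (I.cornerX j) (I.cornerX j + 1) ∧
    I.pointY q ∈ Set.Icc (I.cornerY j) (I.cornerY j + 1)

/-- The first coordinate of a point relative to point `0`. -/
def relPointX (q : ℕ) : ℝ := I.pointX q - I.pointX 0

/-- The second coordinate of a point relative to point `0`. -/
def relPointY (q : ℕ) : ℝ := I.pointY q - I.pointY 0

/-- The first coordinate of the corner of a square relative to point `0`. -/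
def relCornerX (j : ℕ) : ℝ := I.cornerX j - I.pointX 0

/-- The second coordinate of the corner of a square relative to point `0`. -/
def relCornerY (j : ℕ) : ℝ := I.cornerY j - I.pointY 0

/-- All points are at distance at most `K` from point `0` in the maximum norm. -/
def FitsIn : Prop :=
  ∀ q < I.n, |I.relPointX q| ≤ K ∧ |I.relPointY q| ≤ K

/-- The number of squares that the sweep has passed when it arrives at point `q`. -/
noncomputable def cut (q : ℕ) : ℕ :=
  ((Finset.range I.m).filter fun j =>
    sweepKey K (I.relCornerX j) ≤ sweepKey K (I.relPointX q)).card

/-- The number of squares that the sweep has passed when it arrives at square `j`. -/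
noncomputable def rank (j : ℕ) : ℕ :=
  ((Finset.range I.m).filter fun i =>
    sweepKey K (I.relCornerX i) < sweepKey K (I.relCornerX j)).card

/-- The class of a square: the unit cell of the grid through point `0` that contains its corner. -/
noncomputable def squareClass (j : ℕ) : ℤ × ℤ := (⌊I.relCornerX j⌋, ⌊I.relCornerY j⌋)

/-- The key by which the squares of a class are sorted by height, with ties broken by the index. -/
def height (j : ℕ) : ℝ ×ₗ ℕ := toLex (I.cornerY j, j)

end Instance

theorem card_filter_lt_lt_card_filter_le_iff {ι β : Type*} [LinearOrder β] {f : ι → β}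
    {s : Finset ι} {j : ι} (hj : j ∈ s) {a : β} :
    (s.filter fun i => f i < f j).card < (s.filter fun i => f i ≤ a).card ↔ f j ≤ a := by
  constructor
  · contrapose!
    exact fun h => Finset.card_le_card
      (Finset.monotone_filter_right s fun i _ hi => hi.trans_lt h)
  · refine fun h => Finset.card_lt_card ((Finset.ssubset_iff_of_subset
      (Finset.monotone_filter_right s fun i _ hi => hi.le.trans h)).2 ⟨j, ?_, ?_⟩)
    · exact Finset.mem_filter.2 ⟨hj, h⟩
    · simp

namespace Instance

variable {I : Instance} {K : ℕ} {S A : Finset ℕ} {j q : ℕ}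

theorem height_injective : I.height.Injective :=
  fun _ _ h => (Prod.ext_iff.1 (toLex_inj.1 h)).2

theorem cut_le : I.cut K q ≤ I.m := by
  simpa [cut] using Finset.card_filter_le (Finset.range I.m) fun j =>
    sweepKey K (I.relCornerX j) ≤ sweepKey K (I.relPointX q)

theorem rank_lt_cut_iff (hj : j < I.m) :
    I.rank K j < I.cut K q ↔ sweepKey K (I.relCornerX j) ≤ sweepKey K (I.relPointX q) :=
  card_filter_lt_lt_card_filter_le_iff (f := fun j => sweepKey K (I.relCornerX j))
    (Finset.mem_range.2 hj)

theorem covers_iff : I.Covers j q ↔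
    I.relPointX q ∈ Set.Icc (I.relCornerX j) (I.relCornerX j + 1) ∧
      I.relPointY q ∈ Set.Icc (I.relCornerY j) (I.relCornerY j + 1) := by
  simp only [Covers, relPointX, relPointY, relCornerX, relCornerY, Set.mem_Icc,
    sub_le_sub_iff_right, sub_add_eq_add_sub]

theorem FitsIn.relPointX_mem (hI : I.FitsIn K) (hq : q < I.n) :
    I.relPointX q ∈ Set.Ico (-(K + 1) : ℝ) (K + 1) := by
  have := abs_le.1 (hI q hq).1
  constructor <;> linarith

theorem FitsIn.relCorner_mem (hI : I.FitsIn K) (hq : q < I.n) (h : I.Covers j q) :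
    I.relCornerX j ∈ Set.Icc (-(K + 1) : ℝ) K ∧ I.relCornerY j ∈ Set.Icc (-(K + 1) : ℝ) K := by
  obtain ⟨⟨hx, hx'⟩, hy, hy'⟩ := covers_iff.1 h
  obtain ⟨hqx, hqy⟩ := (hI q hq).imp abs_le.1 abs_le.1
  refine ⟨⟨?_, ?_⟩, ?_, ?_⟩ <;> linarith

theorem monotoneOnClasses
    (h : ∀ j ∈ A, I.Covers j q → ∀ i ∈ A, ⌊I.relCornerX i⌋ = ⌊I.relCornerX j⌋ →
      I.relPointX q ∈ Set.Icc (I.relCornerX i) (I.relCornerX i + 1)) :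
    MonotoneOnClasses I.Covers I.squareClass I.height A q := by
  intro j hj hc
  have hle {i k : ℕ} (hik : I.height i ≤ I.height k) : I.relCornerY i ≤ I.relCornerY k :=
    sub_le_sub_right ((Prod.Lex.toLex_le_toLex.1 hik).elim le_of_lt fun h => h.1.le) _
  refine (mem_Icc_monotone_of_floor_eq (covers_iff.1 hc).2).imp ?_ ?_ <;>
  · intro hy i hi hcl hheight
    obtain ⟨hclx, hcly⟩ := Prod.ext_iff.1 hcl
    exact covers_iff.2 ⟨h j hj hc i hi hclx, hy _ hcly (hle hheight)⟩

variable (hI : I.FitsIn K) (hq : q < I.n) (hSm : S ⊆ Finset.range I.m)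
  (hS : ∀ j ∈ S, I.relCornerX j ∈ Set.Ico (-(K + 1) : ℝ) (K + 1))

include hI hq hSm hS

theorem monotoneOnClasses_past : MonotoneOnClasses I.Covers I.squareClass I.height
    (S.filter fun j => I.rank K j < I.cut K q) q := by
  refine monotoneOnClasses fun j hj hc i hi hcl => ?_
  have hx := hI.relPointX_mem hq
  obtain ⟨hjS, hjq⟩ := Finset.mem_filter.1 hj
  obtain ⟨hiS, hiq⟩ := Finset.mem_filter.1 hi
  rw [rank_lt_cut_iff (Finset.mem_range.1 (hSm hjS)),
    sweepKey_le_sweepKey_iff_floor_eq (hS j hjS) hx (covers_iff.1 hc).1] at hjq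
  rw [rank_lt_cut_iff (Finset.mem_range.1 (hSm hiS))] at hiq
  exact mem_Icc_of_floor_eq (hjq.trans hcl.symm)
    (fract_le_fract_of_sweepKey_le (hS i hiS) hx hiq)

theorem monotoneOnClasses_future : MonotoneOnClasses I.Covers I.squareClass I.height
    (S.filter fun j => I.cut K q ≤ I.rank K j) q := by
  refine monotoneOnClasses fun j hj hc i hi hcl => ?_
  have hx := hI.relPointX_mem hq
  have hxj := (covers_iff.1 hc).1
  obtain ⟨hjS, hjq⟩ := Finset.mem_filter.1 hj
  obtain ⟨hiS, hiq⟩ := Finset.mem_filter.1 hi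
  rw [← not_lt, rank_lt_cut_iff (Finset.mem_range.1 (hSm hjS)),
    sweepKey_le_sweepKey_iff_floor_eq (hS j hjS) hx hxj] at hjq
  rw [← not_lt, rank_lt_cut_iff (Finset.mem_range.1 (hSm hiS)), not_le] at hiq
  exact mem_Icc_of_floor_eq_add_one
    (hcl ▸ (floor_eq_or_eq_add_one hxj).resolve_left hjq)
    (fract_le_fract_of_sweepKey_le hx (hS i hiS) hiq.le)

end Instance

theorem Instance.FitsIn.card_window_le {I : Instance} {K : ℕ} (hI : I.FitsIn K) {S : Finset ℕ}
    (hS : ∀ j ∈ S, ∃ q < I.n, I.Covers j q) (r : ℕ) :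
    (window I.squareClass I.height (I.rank K) S r).card ≤ 8 * (2 * K + 2) ^ 2 := by
  have hcard : (Finset.Icc (-(K + 1) : ℤ) K ×ˢ Finset.Icc (-(K + 1) : ℤ) K).card =
      (2 * K + 2) ^ 2 := by
    rw [Finset.card_product, Int.card_Icc, sq]
    congr 1 <;> omega
  rw [← hcard]
  refine UniqueSquareCover.card_window_le height_injective fun j hj => ?_
  obtain ⟨q, hq, hc⟩ := hS j hj
  exact Finset.mem_product.2 ((hI.relCorner_mem hq hc).imp floor_mem_Icc floor_mem_Icc)

/-! ### Longest paths in layered networks -/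

section Network

variable {ι α : Type*}

/-- The number of points of `P` that are incident to exactly one member of `S`. -/
noncomputable def uniqueDepthCount (cov : ι → α → Prop) (P : Finset α) (S : Finset ι) : ℕ :=
  (P.filter fun q => depth cov S q = 1).card

theorem uniqueDepthCount_congr {cov : ι → α → Prop} {P : Finset α} {S T : Finset ι}
    (h : ∀ q ∈ P, depth cov S q = depth cov T q) :
    uniqueDepthCount cov P S = uniqueDepthCount cov P T := by
  rw [uniqueDepthCount, uniqueDepthCount, Finset.filter_congr fun q hq => by rw [h q hq]]

/-- The layered acyclic network on which the sweep is a search for a path of maximal value. Its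
nodes are natural numbers in topological order; node `s` carries the collection `sets s` and is
responsible for the points whose cut is its layer. -/
structure Network (ι α : Type*) where
  cov : ι → α → Prop
  cut : α → ℕ
  points : Finset α
  layer : ℕ → ℕ
  sets : ℕ → Finset ι

namespace Network

variable (G : Network ι α)

/-- The collection of the node covers all points for which the node is responsible. -/
def Valid (s : ℕ) : Prop := ∀ q ∈ G.points, G.cut q = G.layer s → 1 ≤ depth G.cov (G.sets s) q

/-- The number of points that the node contributes to the count of uniquely covered points. -/
noncomputable def value (s : ℕ) : ℕ :=
  (G.points.filter fun q => G.cut q = G.layer s ∧ depth G.cov (G.sets s) q = 1).card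

/-- The sweep may proceed from the node `t` to the node `s`. -/
def Edge (t s : ℕ) : Prop :=
  G.layer t + 1 = G.layer s ∧ Compatible G.cov G.cut G.points (G.layer s) (G.sets t) (G.sets s)

/-- `f` is a path of valid nodes through the layers `0, …, l`. -/
structure IsPath (f : ℕ → ℕ) (l : ℕ) : Prop where
  layer_eq : ∀ r ≤ l, G.layer (f r) = r
  valid : ∀ r ≤ l, G.Valid (f r)
  edge : ∀ r < l, G.Edge (f r) (f (r + 1))

variable {G} {f : ℕ → ℕ} {l : ℕ}

theorem uniqueDepthCount_eq_sum_value {S : Finset ι} (hlayer : ∀ r ≤ l, G.layer (f r) = r)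
    (hcut : ∀ q ∈ G.points, G.cut q ≤ l)
    (h : ∀ q ∈ G.points,
      min (depth G.cov S q) 2 = min (depth G.cov (G.sets (f (G.cut q))) q) 2) :
    uniqueDepthCount G.cov G.points S = ∑ r ∈ Finset.range (l + 1), G.value (f r) := by
  rw [uniqueDepthCount, Finset.card_eq_sum_card_fiberwise (f := G.cut) (t := Finset.range (l + 1))
    fun q hq => Finset.mem_coe.2
      (Finset.mem_range_succ_iff.2 (hcut q (Finset.filter_subset _ _ hq)))]
  refine Finset.sum_congr rfl fun r hr => ?_
  rw [value, hlayer r (Finset.mem_range_succ_iff.1 hr), Finset.filter_filter]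
  refine congrArg _ (Finset.filter_congr fun q hq => ?_)
  have := h q hq
  constructor
  · rintro ⟨h₁, rfl⟩
    exact ⟨rfl, by omega⟩
  · rintro ⟨rfl, h₁⟩
    exact ⟨by omega, rfl⟩

theorem IsPath.min_depth_biUnion [DecidableEq ι] (hf : G.IsPath f l) {q : α} (hq : q ∈ G.points)
    (hcut : G.cut q ≤ l) :
    min (depth G.cov ((Finset.range (l + 1)).biUnion fun r => G.sets (f r)) q) 2 =
      min (depth G.cov (G.sets (f (G.cut q))) q) 2 := by
  refine min_depth_biUnion_of_compatible (W := fun r => G.sets (f r)) (fun r hr => ?_) hq hcut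
  have := (hf.edge r hr).2
  rwa [hf.layer_eq (r + 1) hr] at this

theorem IsPath.one_le_depth_biUnion [DecidableEq ι] (hf : G.IsPath f l) {q : α}
    (hq : q ∈ G.points) (hcut : G.cut q ≤ l) :
    1 ≤ depth G.cov ((Finset.range (l + 1)).biUnion fun r => G.sets (f r)) q := by
  have h₁ := hf.min_depth_biUnion hq hcut
  have h₂ := hf.valid _ hcut q hq (hf.layer_eq _ hcut).symm
  omega

/-! ### The tables of the dynamic program -/

variable (G) in
/-- `b` is `0` if no path of valid nodes from layer `0` reaches `s` through a node below `i`, and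
otherwise one more than the maximal value of such a path, whose last node but one is then `t`
(provided that `s` is not in layer `0`). The table `best` contains these numbers for the nodes
before `s`. -/
structure IsBestEntry (best : ℕ → ℕ) (s i b t : ℕ) : Prop where
  attained : b ≠ 0 → G.Valid s ∧ ((G.layer s = 0 ∧ b = G.value s + 1) ∨
    (t < s ∧ G.Edge t s ∧ best t ≠ 0 ∧ b = best t + G.value s))
  start_le : G.Valid s → G.layer s = 0 → G.value s + 1 ≤ b
  step_le : G.Valid s → ∀ t < i, G.Edge t s → best t ≠ 0 → best t + G.value s ≤ b

section IsBestEntry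

variable {best best' : ℕ → ℕ} {s i b t : ℕ}

theorem isBestEntry_start (hv : G.Valid s) (hl : G.layer s = 0) :
    G.IsBestEntry best s 0 (G.value s + 1) t :=
  ⟨fun _ => ⟨hv, Or.inl ⟨hl, rfl⟩⟩, fun _ _ => le_rfl, fun _ t ht => absurd ht t.not_lt_zero⟩

theorem isBestEntry_none (h : ¬ (G.Valid s ∧ G.layer s = 0)) : G.IsBestEntry best s 0 0 t :=
  ⟨fun h0 => absurd rfl h0, fun hv hl => absurd ⟨hv, hl⟩ h, fun _ t ht => absurd ht t.not_lt_zero⟩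

theorem IsBestEntry.improve (h : G.IsBestEntry best s i b t) (hi : i < s) (hv : G.Valid s)
    (he : G.Edge i s) (hi0 : best i ≠ 0) (hb : b < best i + G.value s) :
    G.IsBestEntry best s (i + 1) (best i + G.value s) i where
  attained _ := ⟨hv, Or.inr ⟨hi, he, hi0, rfl⟩⟩
  start_le hv hl := (h.start_le hv hl).trans hb.le
  step_le hv u hu hus hu0 := by
    rcases Nat.lt_succ_iff_lt_or_eq.1 hu with hu | rfl
    · exact (h.step_le hv u hu hus hu0).trans hb.le
    · exact le_rfl

theorem IsBestEntry.keep (h : G.IsBestEntry best s i b t)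
    (hb : G.Valid s → G.Edge i s → best i ≠ 0 → best i + G.value s ≤ b) :
    G.IsBestEntry best s (i + 1) b t where
  attained := h.attained
  start_le := h.start_le
  step_le hv u hu hus hu0 := by
    rcases Nat.lt_succ_iff_lt_or_eq.1 hu with hu | rfl
    · exact h.step_le hv u hu hus hu0
    · exact hb hv hus hu0

theorem IsBestEntry.congr (h : G.IsBestEntry best s s b t) (hbest : ∀ u < s, best' u = best u) :
    G.IsBestEntry best' s s b t where
  attained hb := (h.attained hb).imp_right <| Or.imp_right fun ⟨ht, he, h0, hb⟩ =>
    ⟨ht, he, (hbest t ht).symm ▸ h0, (hbest t ht).symm ▸ hb⟩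
  start_le := h.start_le
  step_le hv u hu := (hbest u hu).symm ▸ h.step_le hv u hu

end IsBestEntry

variable (G) in
/-- The entries at the node `s` of the tables of maximal values and of predecessors are correct,
relative to the entries at the nodes before `s`. -/
def TableAt (best prev : ℕ → ℕ) (s : ℕ) : Prop := G.IsBestEntry best s s (best s) (prev s)

section Tables

variable {best prev : ℕ → ℕ} {N s : ℕ}

theorem iterate_prev_spec (h : ∀ t < N, G.TableAt best prev t) (hs : s < N) (hb : best s ≠ 0)
    {i : ℕ} (hi : i ≤ G.layer s) :
    prev^[i] s < N ∧ best (prev^[i] s) ≠ 0 ∧ G.layer (prev^[i] s) + i = G.layer s := by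
  induction i with
  | zero => exact ⟨hs, hb, rfl⟩
  | succ i ih =>
    obtain ⟨hN, h0, hl⟩ := ih (Nat.le_of_succ_le hi)
    rw [Function.iterate_succ_apply']
    obtain ⟨-, ⟨hl0, -⟩ | ⟨hlt, he, h0, -⟩⟩ := (h _ hN).attained h0
    · omega
    · exact ⟨hlt.trans hN, h0, by have := he.1; omega⟩

theorem valid_iterate_prev (h : ∀ t < N, G.TableAt best prev t) (hs : s < N) (hb : best s ≠ 0)
    {i : ℕ} (hi : i ≤ G.layer s) : G.Valid (prev^[i] s) := by
  obtain ⟨hN, h0, -⟩ := iterate_prev_spec h hs hb hi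
  exact ((h _ hN).attained h0).1

theorem edge_iterate_prev (h : ∀ t < N, G.TableAt best prev t) (hs : s < N) (hb : best s ≠ 0)
    {i : ℕ} (hi : i < G.layer s) : G.Edge (prev^[i + 1] s) (prev^[i] s) := by
  obtain ⟨hN, h0, hl⟩ := iterate_prev_spec h hs hb hi.le
  rw [Function.iterate_succ_apply']
  obtain ⟨-, ⟨hl0, -⟩ | ⟨-, he, -⟩⟩ := (h _ hN).attained h0
  · omega
  · exact he

theorem best_eq_sum_value (h : ∀ t < N, G.TableAt best prev t) (hs : s < N) (hb : best s ≠ 0) :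
    best s = ∑ i ∈ Finset.range (G.layer s + 1), G.value (prev^[i] s) + 1 := by
  induction hl : G.layer s generalizing s with
  | zero =>
    obtain ⟨-, ⟨-, hb⟩ | ⟨-, he, -⟩⟩ := (h s hs).attained hb
    · simpa using hb
    · have := he.1
      omega
  | succ l ih =>
    obtain ⟨-, ⟨hl0, -⟩ | ⟨hlt, he, h0, hb⟩⟩ := (h s hs).attained hb
    · omega
    · rw [hb, ih (hlt.trans hs) h0 (by have := he.1; omega), Finset.sum_range_succ' _ (l + 1)]
      simp only [Function.iterate_succ_apply, Function.iterate_zero_apply]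
      omega

theorem isPath_iterate_prev (h : ∀ t < N, G.TableAt best prev t) (hs : s < N) (hb : best s ≠ 0)
    (hl : G.layer s = l) : G.IsPath (fun r => prev^[l - r] s) l where
  layer_eq r hr := by
    have := (iterate_prev_spec h hs hb (i := l - r) (by omega)).2.2
    omega
  valid r _ := valid_iterate_prev h hs hb (by omega)
  edge r hr := by
    have := edge_iterate_prev h hs hb (i := l - (r + 1)) (by omega)
    rwa [show l - (r + 1) + 1 = l - r by omega] at this

theorem IsPath.sum_value_lt_best (h : ∀ t < N, G.TableAt best prev t) (hf : G.IsPath f l)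
    (hN : ∀ r ≤ l, f r < N) (hmono : ∀ r < l, f r < f (r + 1)) :
    ∑ r ∈ Finset.range (l + 1), G.value (f r) < best (f l) := by
  induction l with
  | zero =>
    simpa using (h _ (hN 0 le_rfl)).start_le (hf.valid 0 le_rfl) (hf.layer_eq 0 le_rfl)
  | succ l ih =>
    have h₁ := ih ⟨fun r hr => hf.layer_eq r (by omega), fun r hr => hf.valid r (by omega),
      fun r hr => hf.edge r (by omega)⟩ (fun r hr => hN r (by omega)) fun r hr => hmono r (by omega)
    have h₂ := (h _ (hN (l + 1) le_rfl)).step_le (hf.valid _ le_rfl) (f l) (hmono l l.lt_succ_self)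
      (hf.edge l l.lt_succ_self) (Nat.ne_zero_of_lt h₁)
    rw [Finset.sum_range_succ]
    omega

theorem uniqueDepthCount_lt_best (h : ∀ t < N, G.TableAt best prev t) {S : Finset ι}
    (hcut : ∀ q ∈ G.points, G.cut q ≤ l) (hN : ∀ r ≤ l, f r < N)
    (hmono : ∀ r < l, f r < f (r + 1)) (hlayer : ∀ r ≤ l, G.layer (f r) = r)
    (hcomp : ∀ r < l,
      Compatible G.cov G.cut G.points (r + 1) (G.sets (f r)) (G.sets (f (r + 1))))
    (hmin : ∀ q ∈ G.points,
      min (depth G.cov S q) 2 = min (depth G.cov (G.sets (f (G.cut q))) q) 2)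
    (hS : ∀ q ∈ G.points, 1 ≤ depth G.cov S q) :
    uniqueDepthCount G.cov G.points S < best (f l) := by
  rw [uniqueDepthCount_eq_sum_value hlayer hcut hmin]
  refine IsPath.sum_value_lt_best h ⟨hlayer, fun r hr q hq hqr => ?_, fun r hr => ?_⟩ hN hmono
  · rw [hlayer r hr] at hqr
    have h₁ := hqr ▸ hmin q hq
    have h₂ := hS q hq
    omega
  · rw [Edge, hlayer r hr.le, hlayer (r + 1) hr]
    exact ⟨rfl, hcomp r hr⟩

variable [DecidableEq ι]

variable (G) in
/-- The union of the collections along the path of length `l` that ends in `s`. -/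
def traceSet (prev : ℕ → ℕ) (l s : ℕ) : Finset ι :=
  (Finset.range (l + 1)).biUnion fun i => G.sets (prev^[i] s)

theorem traceSet_eq_biUnion (prev : ℕ → ℕ) (l s : ℕ) :
    G.traceSet prev l s = (Finset.range (l + 1)).biUnion fun r => G.sets (prev^[l - r] s) := by
  ext j
  simp only [traceSet, Finset.mem_biUnion, Finset.mem_range]
  constructor <;> rintro ⟨i, hi, hj⟩ <;> refine ⟨l - i, by omega, ?_⟩
  · rwa [Nat.sub_sub_self (by omega)]
  · exact hj

theorem one_le_depth_traceSet (h : ∀ t < N, G.TableAt best prev t) (hs : s < N) (hb : best s ≠ 0)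
    (hl : G.layer s = l) {q : α} (hq : q ∈ G.points) (hcut : G.cut q ≤ l) :
    1 ≤ depth G.cov (G.traceSet prev l s) q := by
  rw [traceSet_eq_biUnion]
  exact (isPath_iterate_prev h hs hb hl).one_le_depth_biUnion hq hcut

theorem best_eq_uniqueDepthCount_traceSet (h : ∀ t < N, G.TableAt best prev t) (hs : s < N)
    (hb : best s ≠ 0) (hl : G.layer s = l) (hcut : ∀ q ∈ G.points, G.cut q ≤ l) :
    best s = uniqueDepthCount G.cov G.points (G.traceSet prev l s) + 1 := by
  have hp := isPath_iterate_prev h hs hb hl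
  rw [uniqueDepthCount_eq_sum_value (f := fun r => prev^[l - r] s) hp.layer_eq hcut fun q hq => by
      rw [traceSet_eq_biUnion, hp.min_depth_biUnion hq (hcut q hq)],
    best_eq_sum_value h hs hb, hl, ← Finset.sum_range_reflect]
  simp only [Nat.add_sub_cancel]

end Tables

end Network

end Network

/-! ### The network of the sweep -/

/-- The collection with which the node `s` is labelled: the set of the last `L` digits of `s` in
base `m + 1`. The digit `m`, which is no square, serves as padding. -/
def nodeSet (m L s : ℕ) : Finset ℕ :=
  ((Finset.range L).image fun i => s / (m + 1) ^ i % (m + 1)).filter (· < m)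

theorem mem_nodeSet_succ {m L s j : ℕ} :
    j ∈ nodeSet m (L + 1) s ↔ j ∈ nodeSet m L s ∨ (s / (m + 1) ^ L % (m + 1) = j ∧ j < m) := by
  simp only [nodeSet, Finset.range_add_one, Finset.image_insert, Finset.mem_filter,
    Finset.mem_insert]
  tauto

theorem nodeSet_subset (m L s : ℕ) : nodeSet m L s ⊆ Finset.range m := fun _ hj =>
  Finset.mem_range.2 (Finset.mem_filter.1 hj).2

theorem exists_nodeSet_eq {m L : ℕ} {W : Finset ℕ} (hW : W ⊆ Finset.range m) (hL : W.card ≤ L)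
    (r : ℕ) : ∃ s, nodeSet m L s = W ∧ s / (m + 1) ^ L = r := by
  induction L generalizing W r with
  | zero =>
    rw [Nat.le_zero, Finset.card_eq_zero] at hL
    exact ⟨r, hL ▸ rfl, by simp⟩
  | succ L ih =>
    obtain ⟨a, V, ha, hV, hVL, hWV⟩ : ∃ a V, a ≤ m ∧ V ⊆ Finset.range m ∧ V.card ≤ L ∧
        ∀ j, j ∈ W ↔ j ∈ V ∨ (a = j ∧ j < m) := by
      rcases W.eq_empty_or_nonempty with rfl | ⟨a, ha⟩
      · exact ⟨m, ∅, le_rfl, by simp, by simp, by simp⟩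
      · refine ⟨a, W.erase a, (Finset.mem_range.1 (hW ha)).le, (W.erase_subset a).trans hW,
          by rw [Finset.card_erase_of_mem ha]; omega, fun j => ?_⟩
        have := fun h : j ∈ W => Finset.mem_range.1 (hW h)
        rw [Finset.mem_erase]
        grind
    obtain ⟨s, hs, hr⟩ := ih hV hVL (a + (m + 1) * r)
    refine ⟨s, ?_, ?_⟩
    · ext j
      rw [mem_nodeSet_succ, hs, hr, Nat.add_mul_mod_self_left, Nat.mod_eq_of_lt (by omega), hWV]
    · rw [pow_succ, ← Nat.div_div_eq_div_mul, hr, Nat.add_mul_div_left _ _ m.succ_pos,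
        Nat.div_eq_of_lt (by omega), zero_add]

namespace Instance

/-- The network of the sweep over an instance whose points are spread over a `K × K` square: a node
is a position of the sweep line with a window of at most `L` squares. -/
noncomputable def network (I : Instance) (K L : ℕ) : Network ℕ ℕ where
  cov := I.Covers
  cut := I.cut K
  points := Finset.range I.n
  layer s := s / (I.m + 1) ^ L
  sets := nodeSet I.m L

variable {I : Instance} {K L : ℕ}

theorem exists_uniqueDepthCount_lt_best (hI : I.FitsIn K) (hL : 8 * (2 * K + 2) ^ 2 ≤ L)
    {best prev : ℕ → ℕ} (h : ∀ s < (I.m + 1) ^ (L + 1), (I.network K L).TableAt best prev s)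
    {S : Finset ℕ} (hSm : S ⊆ Finset.range I.m) (hS : ∀ q < I.n, 1 ≤ depth I.Covers S q) :
    ∃ s < (I.m + 1) ^ (L + 1), s / (I.m + 1) ^ L = I.m ∧
      uniqueDepthCount I.Covers (Finset.range I.n) S < best s := by
  classical
  -- Only squares that contain a point are known to have their corners near point `0`.
  set T := S.filter fun j => ∃ q < I.n, I.Covers j q
  have hdepth (q) (hq : q < I.n) : depth I.Covers S q = depth I.Covers T q :=
    le_antisymm (depth_mono fun j hj hc => Finset.mem_filter.2 ⟨hj, q, hq, hc⟩)
      (depth_mono fun j hj _ => (Finset.mem_filter.1 hj).1)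
  have hTm : T ⊆ Finset.range I.m := (Finset.filter_subset _ _).trans hSm
  have hTx (j) (hj : j ∈ T) : I.relCornerX j ∈ Set.Ico (-(K + 1) : ℝ) (K + 1) := by
    obtain ⟨q, hq, hc⟩ := (Finset.mem_filter.1 hj).2
    exact (hI.relCorner_mem hq hc).1.imp_right fun h => h.trans_lt (lt_add_one _)
  have hpast (q) (hq : q ∈ Finset.range I.n) :=
    monotoneOnClasses_past hI (Finset.mem_range.1 hq) hTm hTx
  have hfuture (q) (hq : q ∈ Finset.range I.n) :=
    monotoneOnClasses_future hI (Finset.mem_range.1 hq) hTm hTx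
  choose f hset hlayer using fun r =>
    show ∃ s, (I.network K L).sets s = window I.squareClass I.height (I.rank K) T r ∧
        (I.network K L).layer s = r from
      exists_nodeSet_eq (window_subset.trans hTm)
        ((hI.card_window_le (fun j hj => (Finset.mem_filter.1 hj).2) r).trans hL) r
  have hN (r) (hr : r ≤ I.m) : f r < (I.m + 1) ^ (L + 1) := by
    rw [pow_succ', ← Nat.div_lt_iff_lt_mul (by positivity)]
    exact (hlayer r).trans_lt (Nat.lt_succ_of_le hr)
  refine ⟨f I.m, hN _ le_rfl, hlayer _, ?_⟩
  rw [uniqueDepthCount_congr fun q hq => hdepth q (Finset.mem_range.1 hq)]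
  refine (I.network K L).uniqueDepthCount_lt_best h (fun q _ => cut_le) hN
    (fun r _ => Nat.lt_of_div_lt_div (c := (I.m + 1) ^ L) ?_) (fun r _ => hlayer r)
    (fun r _ => ?_) (fun q hq => ?_) fun q hq => ?_
  · exact (hlayer r).trans_lt (r.lt_succ_self.trans_eq (hlayer (r + 1)).symm)
  · rw [hset, hset]
    exact compatible_window hpast hfuture
  · rw [hset]
    exact (absorbs_window (hpast q hq) (hfuture q hq)).min_depth_eq window_subset
  · exact hdepth q (Finset.mem_range.1 hq) ▸ hS q (Finset.mem_range.1 hq)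

end Instance

/-! ### The memory layout of the solver -/

namespace Reg

@[simp] abbrev numPoints : ℕ := 0
@[simp] abbrev numSquares : ℕ := 1
@[simp] abbrev answer : ℕ := 2
@[simp] abbrev numNodes : ℕ := 3
@[simp] abbrev point : ℕ := 4
@[simp] abbrev square : ℕ := 5
@[simp] abbrev countPred : ℕ := 6
@[simp] abbrev countCur : ℕ := 7
@[simp] abbrev countBoth : ℕ := 8
@[simp] abbrev index : ℕ := 9
@[simp] abbrev residue : ℕ := 10
@[simp] abbrev quotient : ℕ := 11
@[simp] abbrev node : ℕ := 12
@[simp] abbrev pred : ℕ := 13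
@[simp] abbrev predLayer : ℕ := 14
@[simp] abbrev layer : ℕ := 15
@[simp] abbrev valid : ℕ := 16
@[simp] abbrev value : ℕ := 17
@[simp] abbrev bestEntry : ℕ := 18
@[simp] abbrev prevEntry : ℕ := 19
@[simp] abbrev counter : ℕ := 20
@[simp] abbrev edge : ℕ := 21
@[simp] abbrev product : ℕ := 22

end Reg

namespace NatArr

@[simp] abbrev selected : ℕ := 0
@[simp] abbrev cut : ℕ := 1
@[simp] abbrev predSet : ℕ := 2
@[simp] abbrev nodeSet : ℕ := 3
@[simp] abbrev best : ℕ := 4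
@[simp] abbrev prev : ℕ := 5

end NatArr

namespace RealReg

@[simp] abbrev offset : ℕ := 0

end RealReg

namespace RealArr

@[simp] abbrev pointX : ℕ := 0
@[simp] abbrev pointY : ℕ := 1
@[simp] abbrev cornerX : ℕ := 2
@[simp] abbrev cornerY : ℕ := 3
@[simp] abbrev offset : ℕ := 4

end RealArr

/-- The memory of `σ` holds the instance `I` in the format prescribed for the input. -/
structure HasInput (I : Instance) (σ : State) : Prop where
  numPoints_eq : σ.natVar Reg.numPoints = I.n
  numSquares_eq : σ.natVar Reg.numSquares = I.m
  pointX_eq : σ.realArr RealArr.pointX = I.pointX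
  pointY_eq : σ.realArr RealArr.pointY = I.pointY
  cornerX_eq : σ.realArr RealArr.cornerX = I.cornerX
  cornerY_eq : σ.realArr RealArr.cornerY = I.cornerY

/-- The cells that hold the input. -/
def inputCells : List Cell :=
  [.natVar Reg.numPoints, .natVar Reg.numSquares, .realArr RealArr.pointX,
    .realArr RealArr.pointY, .realArr RealArr.cornerX, .realArr RealArr.cornerY]

/-- The syntactic check that `p` contains no assignment to the cells in `l`. -/
def Program.preserves (p : Program) (l : List Cell) : Bool := l.all fun c => !p.assigns c

theorem Program.preserves_cons {p : Program} {c : Cell} {l : List Cell} :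
    p.preserves (c :: l) ↔ p.assigns c = false ∧ p.preserves l := by
  simp [Program.preserves]

theorem HasInput.frame {I : Instance} {σ τ : State} {p : Program} (h : HasInput I σ)
    (hF : Frame p σ τ) (hp : p.preserves inputCells := by rfl) : HasInput I τ := by
  simp only [inputCells, Program.preserves_cons] at hp
  obtain ⟨h₁, h₂, h₃, h₄, h₅, h₆, -⟩ := hp
  exact ⟨(hF.natVar _ h₁).trans h.numPoints_eq, (hF.natVar _ h₂).trans h.numSquares_eq,
    (hF.realArr _ h₃).trans h.pointX_eq, (hF.realArr _ h₄).trans h.pointY_eq,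
    (hF.realArr _ h₅).trans h.cornerX_eq, (hF.realArr _ h₆).trans h.cornerY_eq⟩

/-- The natural array `a` describes the set `W` of squares: its positive entries among the first `m`
are those with an index in `W`. -/
def Represents (m a : ℕ) (σ : State) (W : Finset ℕ) : Prop :=
  ∀ j < m, (1 ≤ σ.natArr a j ↔ j ∈ W)

theorem Represents.congr {m a : ℕ} {σ τ : State} {W : Finset ℕ} (h : Represents m a σ W)
    (hστ : τ.natArr a = σ.natArr a) : Represents m a τ W := by
  simpa only [Represents, hστ] using h

/-! ### Tests and counters -/

/-- The test for equality of two natural numbers. -/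
def natEq (e f : NatExpr) : BoolExpr := .and (.natLe e f) (.natLe f e)

/-- The test for strict inequality of two natural numbers. -/
def natLt (e f : NatExpr) : BoolExpr := .natLe (.add e (.const 1)) f

/-- The disjunction of two tests. -/
def boolOr (b c : BoolExpr) : BoolExpr := .not (.and (.not b) (.not c))

/-- The test whether the current square belongs to the set described by the array `a`. -/
def memTest (a : ℕ) : BoolExpr := .natLe (.const 1) (.get a (.var Reg.square))

/-- The test whether the current square contains the current point. -/
def coverTest : BoolExpr :=
  .and (.and
      (.realLe (.get RealArr.cornerX (.var Reg.square)) (.get RealArr.pointX (.var Reg.point)))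
      (.realLe (.get RealArr.pointX (.var Reg.point))
        (.add (.get RealArr.cornerX (.var Reg.square)) (.const 1))))
    (.and
      (.realLe (.get RealArr.cornerY (.var Reg.square)) (.get RealArr.pointY (.var Reg.point)))
      (.realLe (.get RealArr.pointY (.var Reg.point))
        (.add (.get RealArr.cornerY (.var Reg.square)) (.const 1))))

section Tests

variable {e f : NatExpr} {b c : BoolExpr} {σ : State} {I : Instance}

@[simp] theorem holds_natEq : (natEq e f).Holds σ ↔ e.eval σ = f.eval σ := le_antisymm_iff.symm

@[simp] theorem holds_natLt : (natLt e f).Holds σ ↔ e.eval σ < f.eval σ := Iff.rfl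

@[simp] theorem holds_boolOr : (boolOr b c).Holds σ ↔ b.Holds σ ∨ c.Holds σ := by
  simp only [boolOr, BoolExpr.Holds, not_and_or, not_not]

theorem Represents.holds_memTest_iff {m a j : ℕ} {W : Finset ℕ} (h : Represents m a σ W)
    (hj : j < m) (hσ : σ.natVar Reg.square = j) : (memTest a).Holds σ ↔ j ∈ W := by
  rw [← h j hj, ← hσ]
  rfl

theorem HasInput.holds_coverTest_iff (h : HasInput I σ) :
    coverTest.Holds σ ↔ I.Covers (σ.natVar Reg.square) (σ.natVar Reg.point) := by
  simp only [coverTest, BoolExpr.Holds, RealExpr.eval, NatExpr.eval, h.pointX_eq, h.pointY_eq,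
    h.cornerX_eq, h.cornerY_eq, Int.cast_one, Instance.Covers, Set.mem_Icc]

end Tests

/-- Count the squares that pass the test `b`. -/
def countIf (out : ℕ) (b : BoolExpr) : Program :=
  .seq (.setNat out (.const 0))
    (.forLoop Reg.square (.var Reg.numSquares)
      (.cond b (.setNat out (.add (.var out) (.const 1))) .skip))

theorem card_filter_range_succ (P : ℕ → Prop) [DecidablePred P] (i : ℕ) :
    ((Finset.range (i + 1)).filter P).card =
      ((Finset.range i).filter P).card + if P i then 1 else 0 := by
  rw [Finset.range_add_one, Finset.filter_insert]
  split_ifs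
  · rw [Finset.card_insert_of_notMem (by simp)]
  · rfl

theorem countIf_spec {out m Y : ℕ} {b : BoolExpr} {σ : State} (P : ℕ → Prop) [DecidablePred P]
    (hout : out ∉ [Reg.numSquares, Reg.square]) (hm : σ.natVar Reg.numSquares = m) (hmY : m ≤ Y)
    (hY : 1 ≤ Y)
    (hb : ∀ j < m, ∀ τ, Frame (countIf out b) σ τ → τ.natVar Reg.square = j →
      (b.Holds τ ↔ P j)) :
    Within (countIf out b) (Y * (b.cost + 30)) σ fun τ =>
      τ.natVar out = ((Finset.range m).filter P).card := by
  simp only [List.mem_cons, List.not_mem_nil, or_false, not_or] at hout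
  have hF₀ : Frame (countIf out b) σ (σ.setNat out 0) :=
    Frame.setNat (by simp [countIf, Program.assigns]) 0
  refine Within.time_mono (Within.seq (Within.setNat (Within.forLoop (b := m)
    (T := 1 + b.cost + (4 + 1)) (fun i τ => τ.natVar out = ((Finset.range i).filter P).card)
    (by simp [Program.assigns, Ne.symm hout.2]) hmY hY (fun τ hF => ?_) ?_ ?_))) ?_
  · refine (hF.natVar _ ?_).trans ?_
    · simp [assigns_forLoop, Program.assigns, Ne.symm hout.1]
    · simp [Ne.symm hout.1, hm]
  · simp [hout.2, NatExpr.eval]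
  · intro i τ hi hF hτ hcount
    have hiff := hb i hi τ (hF₀.trans
      (hF.mono (by simp +contextual [countIf, Program.assigns]))) hτ
    refine Within.cond (fun h => Within.setNat ?_) (fun h => Within.skip ?_)
    · simp [NatExpr.eval, hout.2, hcount, card_filter_range_succ, hiff.1 h]
    · simp [hout.2, hcount, card_filter_range_succ, mt hiff.2 h]
  · simp only [NatExpr.cost]
    nlinarith

open Classical in
theorem card_filter_range_eq_depth {m q : ℕ} {W : Finset ℕ} (hW : W ⊆ Finset.range m)
    (cov : ℕ → ℕ → Prop) :
    ((Finset.range m).filter fun j => j ∈ W ∧ cov j q).card = depth cov W q := by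
  rw [depth]
  congr 1
  ext j
  simp only [Finset.mem_filter, and_iff_right_iff_imp]
  exact fun h => hW h.1

/-! ### Decoding nodes -/

/-- Empty the set described by the array `a`. -/
def clear (a : ℕ) : Program :=
  .forLoop Reg.square (.var Reg.numSquares) (.putNat a (.var Reg.square) (.const 0))

theorem clear_spec {I : Instance} {a Y : ℕ} {σ : State} (h : HasInput I σ) (hmY : I.m ≤ Y)
    (hY : 1 ≤ Y) : Within (clear a) (Y * 21) σ fun τ => Represents I.m a τ ∅ := by
  suffices hzero : Within (clear a) (Y * 21) σ fun τ => ∀ j < I.m, τ.natArr a j = 0 from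
    hzero.imp le_rfl fun τ _ hτ j hj => by simp [hτ j hj]
  refine Within.forLoop (T := 3) (fun i τ => ∀ j < i, τ.natArr a j = 0) rfl hmY hY
    (fun τ hF => (h.frame hF).numSquares_eq) (by simp) fun i τ _ _ hi hzero =>
    Within.putNat (i := .var Reg.square) (e := .const 0) fun j hj => ?_
  simp only [NatExpr.eval, hi, State.setNat_natArr, State.putNat_natArr, if_true,
    Function.update_apply]
  split_ifs
  · rfl
  · exact hzero j (by omega)

/-- Divide the variable `Reg.residue` by `m + 1` and insert the remainder into the set described by
the array `a`. The remainder `m`, which is not the index of a square, stands for no square. -/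
def extractDigit (a : ℕ) : Program :=
  .seq (.setNat Reg.quotient (.const 0)) <|
  .seq (.loop (.natLe (.add (.var Reg.numSquares) (.const 1)) (.var Reg.residue))
    (.seq (.setNat Reg.residue (.sub (.var Reg.residue) (.add (.var Reg.numSquares) (.const 1))))
      (.setNat Reg.quotient (.add (.var Reg.quotient) (.const 1))))) <|
  .seq (.putNat a (.var Reg.residue) (.const 1)) (.setNat Reg.residue (.var Reg.quotient))

theorem extractDigit_spec {a m s Y : ℕ} {σ : State} (hm : σ.natVar Reg.numSquares = m)
    (hs : σ.natVar Reg.residue = s) (hsY : s < Y) :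
    Within (extractDigit a) (Y * 40) σ fun τ => τ.natVar Reg.residue = s / (m + 1) ∧
      τ.natArr a = Function.update (σ.natArr a) (s % (m + 1)) 1 := by
  let Inv : State → Prop := fun τ => τ.natVar Reg.numSquares = m ∧
    τ.natVar Reg.residue + (m + 1) * τ.natVar Reg.quotient = s ∧ τ.natArr = σ.natArr
  refine Within.time_mono (Within.seq (Within.setNat (Within.bind (Within.loop (T := 10) Inv
    (fun τ => τ.natVar Reg.residue) ?_ ?_) (U := 5) ?_))) ?_
  · rintro τ ⟨h1, h2, h3⟩ hle
    simp only [BoolExpr.Holds, NatExpr.eval, h1, Reg.residue, Reg.quotient] at h2 hle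
    refine Within.time_mono (Within.seq (Within.setNat (Within.setNat ?_))) le_rfl
    refine ⟨⟨?_, ?_, ?_⟩, ?_⟩ <;> simp [NatExpr.eval, h1, h3, mul_add]
    all_goals omega
  · simp [Inv, NatExpr.eval, hm, hs]
  · rintro τ - ⟨⟨h1, h2, h3⟩, hle⟩
    simp only [BoolExpr.Holds, NatExpr.eval, h1] at hle
    obtain ⟨hdiv, hmod⟩ : s / (m + 1) = τ.natVar Reg.quotient ∧
        s % (m + 1) = τ.natVar Reg.residue :=
      (Nat.div_mod_unique (Nat.succ_pos m)).2 ⟨by omega, by omega⟩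
    refine Within.seq (Within.putNat (Within.setNat ?_))
    simp [NatExpr.eval, hdiv, hmod, h3]
  · simp [NatExpr.cost, BoolExpr.cost, NatExpr.eval, hs]
    omega

/-- Decode the node in the variable `src`: put its set of squares into the array `a` and its layer
into the variable `out`. -/
def decode (L src a out : ℕ) : Program :=
  .seq (clear a) <|
  .seq (.setNat Reg.residue (.var src)) <|
  .seq (.forLoop Reg.index (.const L) (extractDigit a))
    (.setNat out (.var Reg.residue))

theorem extractDigits_spec {I : Instance} {L a s Y : ℕ} {σ : State} (h : HasInput I σ)
    (hs : σ.natVar Reg.residue = s) (hsY : s < Y) (ha : Represents I.m a σ ∅) :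
    Within (.forLoop Reg.index (.const L) (extractDigit a)) ((L + 1) * (Y * 40 + 18)) σ fun τ =>
      τ.natVar Reg.residue = s / (I.m + 1) ^ L ∧ Represents I.m a τ (nodeSet I.m L s) := by
  refine Within.forLoop (fun i τ => τ.natVar Reg.residue = s / (I.m + 1) ^ i ∧
    Represents I.m a τ (nodeSet I.m i s)) rfl (Nat.le_succ L) (by omega) (fun _ _ => rfl)
    ⟨by simp [hs], ha⟩ ?_
  rintro i τ - hF - ⟨hres, hrep⟩
  refine (extractDigit_spec (h.frame hF).numSquares_eq hres
    ((Nat.div_le_self _ _).trans_lt hsY)).imp le_rfl ?_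
  rintro υ - ⟨hres', harr⟩
  refine ⟨by simp [hres', pow_succ, Nat.div_div_eq_div_mul], fun j hj => ?_⟩
  rw [mem_nodeSet_succ, ← hrep j hj, State.setNat_natArr, harr, Function.update_apply]
  split_ifs with hd
  · simp [← hd, hj]
  · simp [Ne.symm hd]

theorem decode_spec {I : Instance} {L src a out s Y : ℕ} {σ : State} (h : HasInput I σ)
    (hsrc : src ≠ Reg.square) (hs : σ.natVar src = s) (hsY : s < Y) (hmY : I.m ≤ Y) :
    Within (decode L src a out) (Y * ((L + 1) * 90)) σ fun τ =>
      Represents I.m a τ (nodeSet I.m L s) ∧ τ.natVar out = s / (I.m + 1) ^ L := by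
  refine Within.time_mono (Within.bind (clear_spec h hmY (by omega)) fun τ hF hτ =>
    Within.seq (Within.setNat (Within.bind (extractDigits_spec (s := s) ((h.frame hF).frame
      (Frame.setNat (p := .setNat Reg.residue (.var src)) (by rfl) _)) ?_ hsY (hτ.congr rfl))
      fun υ _ hυ => Within.setNat ⟨hυ.2.congr rfl, by simp [NatExpr.eval, hυ.1]⟩))) ?_
  · simpa [NatExpr.eval, hs] using
      hF.natVar src (by simp [clear, assigns_forLoop, Program.assigns, hsrc])
  · simp only [NatExpr.cost]
    nlinarith [Nat.le_mul_of_pos_left (L + 1) (by omega : 0 < Y)]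

/-! ### Checking nodes and edges -/

/-- The memory of `σ` holds the instance `I` and the cuts of its points. -/
structure Prepared (I : Instance) (K : ℕ) (σ : State) : Prop extends HasInput I σ where
  cut_eq : ∀ q < I.n, σ.natArr NatArr.cut q = I.cut K q

/-- The memory of `σ` is prepared, and the node `s` is decoded as the current node. -/
structure NodeLoaded (I : Instance) (K L s : ℕ) (σ : State) : Prop extends Prepared I K σ where
  layer_eq : σ.natVar Reg.layer = (I.network K L).layer s
  represents : Represents I.m NatArr.nodeSet σ ((I.network K L).sets s)

/-- The memory of `σ` is prepared, the node `s` is decoded as the current node and the node `t` as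
the candidate for its predecessor. -/
structure EdgeLoaded (I : Instance) (K L t s : ℕ) (σ : State) : Prop
    extends NodeLoaded I K L s σ where
  predLayer_eq : σ.natVar Reg.predLayer = (I.network K L).layer t
  represents_pred : Represents I.m NatArr.predSet σ ((I.network K L).sets t)

/-- The cells on which `Prepared` depends. -/
def preparedCells : List Cell := .natArr NatArr.cut :: inputCells

/-- The cells on which `NodeLoaded` depends. -/
def nodeCells : List Cell := .natVar Reg.layer :: .natArr NatArr.nodeSet :: preparedCells

/-- The cells on which `EdgeLoaded` depends. -/
def edgeCells : List Cell := .natVar Reg.predLayer :: .natArr NatArr.predSet :: nodeCells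

section Checks

variable {I : Instance} {K L s t q Y : ℕ} {σ τ : State} {p : Program}

theorem Prepared.frame (h : Prepared I K σ) (hF : Frame p σ τ)
    (hp : p.preserves preparedCells := by rfl) : Prepared I K τ := by
  obtain ⟨hcut, hp⟩ := Program.preserves_cons.1 hp
  exact ⟨h.toHasInput.frame hF hp, by simpa only [hF.natArr _ hcut] using h.cut_eq⟩

theorem NodeLoaded.frame (h : NodeLoaded I K L s σ) (hF : Frame p σ τ)
    (hp : p.preserves nodeCells := by rfl) : NodeLoaded I K L s τ := by
  simp only [nodeCells, Program.preserves_cons] at hp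
  obtain ⟨hlayer, hset, hp⟩ := hp
  exact ⟨h.toPrepared.frame hF hp, (hF.natVar _ hlayer).trans h.layer_eq,
    h.represents.congr (hF.natArr _ hset)⟩

theorem EdgeLoaded.frame (h : EdgeLoaded I K L t s σ) (hF : Frame p σ τ)
    (hp : p.preserves edgeCells := by rfl) : EdgeLoaded I K L t s τ := by
  simp only [edgeCells, Program.preserves_cons] at hp
  obtain ⟨hlayer, hset, hp⟩ := hp
  exact ⟨h.toNodeLoaded.frame hF hp, (hF.natVar _ hlayer).trans h.predLayer_eq,
    h.represents_pred.congr (hF.natArr _ hset)⟩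

theorem countCovering_spec {out : ℕ} {b : BoolExpr} {W : Finset ℕ} (hout : Reg.square < out)
    (h : HasInput I σ) (hq : σ.natVar Reg.point = q) (hmY : I.m ≤ Y) (hY : 1 ≤ Y)
    (hW : W ⊆ Finset.range I.m) (hcost : b.cost ≤ 12)
    (hb : ∀ j < I.m, ∀ τ, τ.natArr = σ.natArr → τ.natVar Reg.square = j → (b.Holds τ ↔ j ∈ W)) :
    Within (countIf out (.and b coverTest)) (Y * 70) σ fun τ =>
      τ.natVar out = depth I.Covers W q := by
  classical
  rw [← card_filter_range_eq_depth hW]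
  have hne : ∀ x ≤ Reg.square, x ≠ out := fun x hx => (hx.trans_lt hout).ne
  refine (countIf_spec (fun j => j ∈ W ∧ I.Covers j q) ?_ h.numSquares_eq hmY hY
    fun j hj τ hF hτ => ?_).time_mono (Nat.mul_le_mul_left _ ?_)
  · simp only [List.mem_cons, List.not_mem_nil, or_false, not_or]
    exact ⟨(hne _ (by simp)).symm, (hne _ le_rfl).symm⟩
  · have hinput : HasInput I τ := h.frame hF (by
      simp [Program.preserves, inputCells, countIf, assigns_forLoop, Program.assigns, hne])
    have hpoint : τ.natVar Reg.point = q := (hF.natVar _ (by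
      simp [countIf, assigns_forLoop, Program.assigns, hne])).trans hq
    have harr : τ.natArr = σ.natArr := funext fun a => hF.natArr a (by
      simp [countIf, assigns_forLoop, Program.assigns])
    rw [BoolExpr.Holds, hb j hj τ harr hτ, hinput.holds_coverTest_iff, hpoint, hτ]
  · simp only [BoolExpr.cost, coverTest, RealExpr.cost, NatExpr.cost]
    omega

theorem NodeLoaded.countMembers_spec (h : NodeLoaded I K L s σ) (hq : σ.natVar Reg.point = q)
    (hmY : I.m ≤ Y) (hY : 1 ≤ Y) :
    Within (countIf Reg.countCur (.and (memTest NatArr.nodeSet) coverTest)) (Y * 70) σ fun τ =>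
      τ.natVar Reg.countCur = depth I.Covers ((I.network K L).sets s) q :=
  countCovering_spec (by simp) h.toHasInput hq hmY hY (nodeSet_subset _ _ _)
    (by simp [memTest, BoolExpr.cost, NatExpr.cost]) fun _ hj _ harr hτ =>
    (h.represents.congr (congrFun harr _)).holds_memTest_iff hj hτ

/-- Update validity and value of the current node by the current point, of depth `Reg.countCur`. -/
def recordDepth : Program :=
  .seq (.cond (natEq (.var Reg.countCur) (.const 0)) (.setNat Reg.valid (.const 0)) .skip)
    (.cond (natEq (.var Reg.countCur) (.const 1))
      (.setNat Reg.value (.add (.var Reg.value) (.const 1))) .skip)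

theorem recordDepth_spec {d : ℕ} (hd : σ.natVar Reg.countCur = d) :
    Within recordDepth 26 σ fun τ =>
      (τ.natVar Reg.valid = 1 ↔ σ.natVar Reg.valid = 1 ∧ 1 ≤ d) ∧
      τ.natVar Reg.value = σ.natVar Reg.value + if d = 1 then 1 else 0 := by
  have hvalid : Within (.cond (natEq (.var Reg.countCur) (.const 0))
      (.setNat Reg.valid (.const 0)) .skip) 11 σ fun τ =>
      (τ.natVar Reg.valid = 1 ↔ σ.natVar Reg.valid = 1 ∧ 1 ≤ d) := by
    refine Within.cond (fun h => Within.setNat ?_) fun h => Within.skip ?_ <;>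
      simp only [holds_natEq, NatExpr.eval, hd] at h
    · simp [NatExpr.eval, h]
    · simp [Nat.one_le_iff_ne_zero, h]
  refine Within.bind hvalid (U := 15) fun τ hF hτ => Within.time_mono
    (Within.cond (fun h => Within.setNat ?_) fun h => Within.skip ?_)
    (by simp [natEq, BoolExpr.cost, NatExpr.cost]) <;>
    simp only [holds_natEq, NatExpr.eval, hF.natVar Reg.countCur rfl, hd] at h <;>
    simp [NatExpr.eval, hτ, h, ← hF.natVar Reg.value rfl]

/-- Update validity and value of the current node by the current point. -/
def checkPoint : Program :=
  .cond (natEq (.get NatArr.cut (.var Reg.point)) (.var Reg.layer))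
    (.seq (countIf Reg.countCur (.and (memTest NatArr.nodeSet) coverTest)) recordDepth) .skip

theorem checkPoint_spec (h : NodeLoaded I K L s σ) (hq : σ.natVar Reg.point = q) (hqn : q < I.n)
    (hmY : I.m ≤ Y) (hY : 1 ≤ Y) :
    Within checkPoint (Y * 70 + 40) σ fun τ =>
      (τ.natVar Reg.valid = 1 ↔ σ.natVar Reg.valid = 1 ∧ (I.cut K q = (I.network K L).layer s →
        1 ≤ depth I.Covers ((I.network K L).sets s) q)) ∧
      τ.natVar Reg.value = σ.natVar Reg.value + if I.cut K q = (I.network K L).layer s ∧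
        depth I.Covers ((I.network K L).sets s) q = 1 then 1 else 0 := by
  refine Within.time_mono (Within.cond (T := Y * 70 + 26) (fun hcut => ?_)
    fun hcut => Within.skip ?_) ?_
  · simp only [holds_natEq, NatExpr.eval, hq, h.cut_eq q hqn, h.layer_eq] at hcut
    simp only [hcut, true_and, forall_true_left]
    refine Within.bind (h.countMembers_spec hq hmY hY) fun τ hF hτ => ?_
    simpa only [hF.natVar Reg.valid rfl, hF.natVar Reg.value rfl] using recordDepth_spec hτ
  · simp only [holds_natEq, NatExpr.eval, hq, h.cut_eq q hqn, h.layer_eq] at hcut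
    simp [hcut]
  · simp only [natEq, NatExpr.cost, BoolExpr.cost]
    omega

/-- Compute validity and value of the current node. -/
def checkNode : Program :=
  .seq (.setNat Reg.valid (.const 1)) <|
  .seq (.setNat Reg.value (.const 0)) <|
  .forLoop Reg.point (.var Reg.numPoints) checkPoint

theorem checkNode_spec (h : NodeLoaded I K L s σ) (hmY : I.m ≤ Y) (hY : 1 ≤ Y) :
    Within checkNode ((I.n + 1) * (Y * 140)) σ fun τ =>
      (τ.natVar Reg.valid = 1 ↔ (I.network K L).Valid s) ∧
      τ.natVar Reg.value = (I.network K L).value s := by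
  let Inv (i : ℕ) (τ : State) : Prop :=
    (τ.natVar Reg.valid = 1 ↔ ∀ q ∈ Finset.range i, I.cut K q = (I.network K L).layer s →
      1 ≤ depth I.Covers ((I.network K L).sets s) q) ∧
    τ.natVar Reg.value = ((Finset.range i).filter fun q => I.cut K q = (I.network K L).layer s ∧
      depth I.Covers ((I.network K L).sets s) q = 1).card
  refine Within.time_mono (Within.seq (Within.setNat (Within.seq (Within.setNat
    (Within.forLoop (Y := I.n + 1) (T := Y * 70 + 40) Inv rfl (Nat.le_succ _) (Nat.succ_pos _)
      (fun τ hF => (hF.natVar Reg.numPoints rfl).trans h.numPoints_eq) ?_ ?_))))) ?_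
  · simp [Inv, NatExpr.eval]
  · rintro i τ hi hF hτ ⟨hvalid, hvalue⟩
    have hloaded : NodeLoaded I K L s τ := h.frame (p := checkNode)
      (((Frame.setNat rfl _).trans (Frame.setNat rfl _)).trans
        (hF.mono (by simp +contextual [checkNode, Program.assigns])))
    refine (checkPoint_spec hloaded hτ hi hmY hY).imp le_rfl ?_
    rintro υ - ⟨hvalid', hvalue'⟩
    constructor
    · rw [Finset.range_add_one, Finset.forall_mem_insert, and_comm, ← hvalid]
      simpa using hvalid'
    · rw [card_filter_range_succ, ← hvalue]
      simpa using hvalue'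
  · simp only [NatExpr.cost]
    nlinarith

/-- Count the squares through the current point in the set of the predecessor, in that of the
current node, and in both. -/
def countDepths : Program :=
  .seq (countIf Reg.countPred (.and (memTest NatArr.predSet) coverTest)) <|
  .seq (countIf Reg.countCur (.and (memTest NatArr.nodeSet) coverTest)) <|
  countIf Reg.countBoth (.and (.and (memTest NatArr.predSet) (memTest NatArr.nodeSet)) coverTest)

theorem EdgeLoaded.countPred_spec (h : EdgeLoaded I K L t s σ) (hq : σ.natVar Reg.point = q)
    (hmY : I.m ≤ Y) (hY : 1 ≤ Y) :
    Within (countIf Reg.countPred (.and (memTest NatArr.predSet) coverTest)) (Y * 70) σ fun τ =>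
      τ.natVar Reg.countPred = depth I.Covers ((I.network K L).sets t) q :=
  countCovering_spec (by simp) h.toHasInput hq hmY hY (nodeSet_subset _ _ _)
    (by simp [memTest, BoolExpr.cost, NatExpr.cost]) fun _ hj _ harr hτ =>
    (h.represents_pred.congr (congrFun harr _)).holds_memTest_iff hj hτ

theorem EdgeLoaded.countBoth_spec (h : EdgeLoaded I K L t s σ) (hq : σ.natVar Reg.point = q)
    (hmY : I.m ≤ Y) (hY : 1 ≤ Y) :
    Within (countIf Reg.countBoth
      (.and (.and (memTest NatArr.predSet) (memTest NatArr.nodeSet)) coverTest)) (Y * 70) σ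
      fun τ => τ.natVar Reg.countBoth =
        depth I.Covers ((I.network K L).sets t ∩ (I.network K L).sets s) q := by
  refine countCovering_spec (by simp) h.toHasInput hq hmY hY
    (Finset.inter_subset_left.trans (nodeSet_subset _ _ _))
    (by simp [memTest, BoolExpr.cost, NatExpr.cost]) fun j hj τ harr hτ => ?_
  rw [Finset.mem_inter, BoolExpr.Holds,
    (h.represents_pred.congr (congrFun harr _)).holds_memTest_iff hj hτ,
    (h.represents.congr (congrFun harr _)).holds_memTest_iff hj hτ]

theorem countDepths_spec (h : EdgeLoaded I K L t s σ) (hq : σ.natVar Reg.point = q)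
    (hmY : I.m ≤ Y) (hY : 1 ≤ Y) :
    Within countDepths (Y * 210) σ fun τ =>
      τ.natVar Reg.countPred = depth I.Covers ((I.network K L).sets t) q ∧
      τ.natVar Reg.countCur = depth I.Covers ((I.network K L).sets s) q ∧
      τ.natVar Reg.countBoth =
        depth I.Covers ((I.network K L).sets t ∩ (I.network K L).sets s) q := by
  refine Within.time_mono (Within.bind (h.countPred_spec hq hmY hY) fun τ₁ hF₁ h₁ =>
    Within.bind ((h.frame hF₁).countMembers_spec ((hF₁.natVar _ rfl).trans hq) hmY hY)
      fun τ₂ hF₂ h₂ =>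
    (((h.frame hF₁).frame hF₂).countBoth_spec
      ((hF₂.natVar _ rfl).trans ((hF₁.natVar _ rfl).trans hq)) hmY hY).imp le_rfl
      fun τ₃ hF₃ h₃ => ⟨?_, (hF₃.natVar _ rfl).trans h₂, h₃⟩) (by omega)
  exact (hF₃.natVar _ rfl).trans ((hF₂.natVar _ rfl).trans h₁)

/-- The test whether the current point violates the compatibility of the predecessor with the
current node. -/
def conflictTest : BoolExpr :=
  boolOr
    (.and (.natLe (.var Reg.layer) (.get NatArr.cut (.var Reg.point)))
      (.and (natLt (.var Reg.countBoth) (.var Reg.countPred))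
        (natLt (.var Reg.countCur) (.const 2))))
    (.and (natLt (.get NatArr.cut (.var Reg.point)) (.var Reg.layer))
      (.and (natLt (.var Reg.countBoth) (.var Reg.countCur))
        (natLt (.var Reg.countPred) (.const 2))))

theorem not_holds_conflictTest_iff {cov : ℕ → ℕ → Prop} {c r : ℕ} {A B : Finset ℕ}
    (hc : σ.natArr NatArr.cut (σ.natVar Reg.point) = c) (hr : σ.natVar Reg.layer = r)
    (hA : σ.natVar Reg.countPred = depth cov A q) (hB : σ.natVar Reg.countCur = depth cov B q)
    (hAB : σ.natVar Reg.countBoth = depth cov (A ∩ B) q) :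
    ¬ conflictTest.Holds σ ↔ (r ≤ c → Absorbs cov A B q) ∧ (c < r → Absorbs cov B A q) := by
  rw [absorbs_iff, absorbs_iff, Finset.inter_comm B A]
  simp only [conflictTest, holds_boolOr, BoolExpr.Holds, holds_natLt, NatExpr.eval, hc, hr, hA, hB,
    hAB]
  omega

/-- Test whether there is an edge from the predecessor to the current node. -/
def checkEdge : Program :=
  .seq (.cond (natEq (.add (.var Reg.predLayer) (.const 1)) (.var Reg.layer))
    (.setNat Reg.edge (.const 1)) (.setNat Reg.edge (.const 0))) <|
  .forLoop Reg.point (.var Reg.numPoints) <|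
  .seq countDepths (.cond conflictTest (.setNat Reg.edge (.const 0)) .skip)

theorem checkEdge_body_spec (h : EdgeLoaded I K L t s σ) (hq : σ.natVar Reg.point = q)
    (hqn : q < I.n) (hmY : I.m ≤ Y) (hY : 1 ≤ Y) :
    Within (.seq countDepths (.cond conflictTest (.setNat Reg.edge (.const 0)) .skip))
      (Y * 210 + 60) σ fun τ => τ.natVar Reg.edge = 1 ↔ σ.natVar Reg.edge = 1 ∧
        ((I.network K L).layer s ≤ I.cut K q →
          Absorbs I.Covers ((I.network K L).sets t) ((I.network K L).sets s) q) ∧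
        (I.cut K q < (I.network K L).layer s →
          Absorbs I.Covers ((I.network K L).sets s) ((I.network K L).sets t) q) := by
  refine Within.bind (countDepths_spec h hq hmY hY) ?_
  rintro τ hF ⟨hA, hB, hAB⟩
  have hpoint : τ.natVar Reg.point = q := (hF.natVar _ rfl).trans hq
  rw [← not_holds_conflictTest_iff (hpoint ▸ (h.frame hF).cut_eq q hqn) (h.frame hF).layer_eq
    hA hB hAB, ← hF.natVar Reg.edge rfl]
  refine Within.time_mono (Within.cond (fun hc => Within.setNat ?_) fun hc => Within.skip ?_)
    (by simp [conflictTest, boolOr, natLt, BoolExpr.cost, NatExpr.cost])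
  · simp [NatExpr.eval, hc]
  · simp [hc]

theorem checkEdge_spec (h : EdgeLoaded I K L t s σ) (hmY : I.m ≤ Y) (hY : 1 ≤ Y) :
    Within checkEdge ((I.n + 1) * (Y * 310)) σ fun τ =>
      (τ.natVar Reg.edge = 1 ↔ (I.network K L).Edge t s) := by
  let G := I.network K L
  let Inv (i : ℕ) (τ : State) : Prop := τ.natVar Reg.edge = 1 ↔ G.layer t + 1 = G.layer s ∧
    Compatible G.cov G.cut (Finset.range i) (G.layer s) (G.sets t) (G.sets s)
  refine Within.time_mono (Within.bind (Within.cond (Q := fun τ => τ.natVar Reg.edge = 1 ↔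
    G.layer t + 1 = G.layer s) (fun hl => Within.setNat ?_) (fun hl => Within.setNat ?_))
    fun τ hF hτ => Within.forLoop (b := I.n) (Y := I.n + 1) (T := Y * 210 + 60) Inv rfl
      (Nat.le_succ _) (Nat.succ_pos _) (fun υ hFυ => ((h.frame hF).frame hFυ).numPoints_eq)
      ?_ ?_) ?_
  · simpa [NatExpr.eval, h.layer_eq, h.predLayer_eq] using hl
  · simpa [NatExpr.eval, h.layer_eq, h.predLayer_eq] using hl
  · simpa [Inv, Compatible] using hτ
  · intro i υ hi hFυ hυ hInv
    refine (checkEdge_body_spec ((h.frame hF).frame hFυ) hυ hi hmY hY).imp le_rfl fun χ _ hχ => ?_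
    have hχ' : (χ.setNat Reg.point (i + 1)).natVar Reg.edge = χ.natVar Reg.edge := by simp
    simp only [Inv] at hInv ⊢
    rw [hχ', hχ, hInv, Compatible, Compatible, Finset.range_add_one, Finset.forall_mem_insert,
      and_assoc, and_comm (b := ∀ q ∈ Finset.range i, _)]
    rfl
  · simp only [natEq, BoolExpr.cost, NatExpr.cost]
    nlinarith

end Checks

/-! ### Preparation of the memory -/

/-- Compute the offset of `src` relative to the first point. -/
def computeOffset (K : ℕ) (src : RealExpr) : Program :=
  .seq (.setReal RealReg.offset
    (.add (.sub src (.get RealArr.pointX (.const 0))) (.const (K + 1)))) <|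
  .forLoop Reg.index (.const (2 * K + 1)) <|
  .cond (.realLe (.const 1) (.var RealReg.offset))
    (.setReal RealReg.offset (.sub (.var RealReg.offset) (.const 1))) .skip

/-- Compute the offsets of the squares. -/
def computeOffsets (K : ℕ) : Program :=
  .forLoop Reg.square (.var Reg.numSquares) <|
  .seq (computeOffset K (.get RealArr.cornerX (.var Reg.square)))
    (.putReal RealArr.offset (.var Reg.square) (.var RealReg.offset))

/-- The test whether the sweep passes the current square no later than the current point. -/
def passedTest : BoolExpr :=
  boolOr (.not (.realLe (.var RealReg.offset) (.get RealArr.offset (.var Reg.square))))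
    (.and (.realLe (.get RealArr.offset (.var Reg.square)) (.var RealReg.offset))
      (.realLe (.get RealArr.pointX (.var Reg.point)) (.get RealArr.cornerX (.var Reg.square))))

/-- Compute the cut of the current point. -/
def computeCut (K : ℕ) : Program :=
  .seq (computeOffset K (.get RealArr.pointX (.var Reg.point))) <|
  .seq (countIf Reg.countPred passedTest) <|
  .putNat NatArr.cut (.var Reg.point) (.var Reg.countPred)

/-- Compute the cuts of the points. -/
def computeCuts (K : ℕ) : Program :=
  .forLoop Reg.point (.var Reg.numPoints) (computeCut K)

/-- Multiply the number of nodes by `m + 1`. -/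
def multiplyNodes : Program :=
  .seq (.setNat Reg.product (.const 0)) <|
  .seq (.forLoop Reg.counter (.add (.var Reg.numSquares) (.const 1))
    (.setNat Reg.product (.add (.var Reg.product) (.var Reg.numNodes)))) <|
  .setNat Reg.numNodes (.var Reg.product)

/-- Compute the number `(m + 1) ^ (L + 1)` of nodes. -/
def countNodes (L : ℕ) : Program :=
  .seq (.setNat Reg.numNodes (.const 1)) (.forLoop Reg.index (.const (L + 1)) multiplyNodes)

/-- Compute the cuts of the points and the number of nodes. -/
def prepare (K L : ℕ) : Program :=
  .seq (computeOffsets K) (.seq (computeCuts K) (countNodes L))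

section Preparation

variable {I : Instance} {K L Y : ℕ} {σ : State}

theorem computeOffset_spec {src : RealExpr} {x : ℝ} (h : HasInput I σ) (hx : src.eval σ = x) :
    Within (computeOffset K src) (src.cost + (2 * K + 2) * 40) σ fun τ =>
      τ.realVar RealReg.offset = offset K (x - I.pointX 0) := by
  refine Within.time_mono (Within.seq (Within.setReal (Within.forLoop (b := 2 * K + 1)
    (Y := 2 * K + 1) (T := 10) (fun i τ => τ.realVar RealReg.offset =
      decrease^[i] (x - I.pointX 0 + (K + 1 : ℕ))) rfl le_rfl (by omega) (fun _ _ => rfl) ?_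
        fun i τ _ _ _ hτ => ?_))) ?_
  · simp [RealExpr.eval, NatExpr.eval, hx, h.pointX_eq]
  · rw [Function.iterate_succ_apply', ← hτ]
    refine Within.time_mono (Within.cond (fun hle => Within.setReal ?_) fun hlt => Within.skip ?_)
      (by simp [BoolExpr.cost, RealExpr.cost])
    · simp only [BoolExpr.Holds, RealExpr.eval, Int.cast_one] at hle
      simp [RealExpr.eval, decrease, hle]
    · simp only [BoolExpr.Holds, RealExpr.eval, Int.cast_one] at hlt
      simp [decrease, hlt]
  · simp only [RealExpr.cost, NatExpr.cost]
    omega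

theorem computeOffsets_spec (h : HasInput I σ) (hmY : I.m ≤ Y) (hY : 1 ≤ Y) :
    Within (computeOffsets K) (Y * ((K + 1) * 110)) σ fun τ =>
      ∀ j < I.m, τ.realArr RealArr.offset j = offset K (I.relCornerX j) := by
  refine Within.time_mono (Within.forLoop (T := (2 + (2 * K + 2) * 40) + 3)
    (fun i τ => ∀ j < i, τ.realArr RealArr.offset j = offset K (I.relCornerX j)) rfl hmY hY
    (fun τ hF => (h.frame hF).numSquares_eq) (by simp) fun i τ _ hF hi hτ => ?_)
    (Nat.mul_le_mul_left _ ?_)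
  · refine Within.bind (computeOffset_spec (x := I.cornerX i) (h.frame hF) ?_)
      fun υ hFυ hυ => Within.putReal (i := .var Reg.square) (e := .var RealReg.offset) ?_
    · simp [RealExpr.eval, NatExpr.eval, hi, (h.frame hF).cornerX_eq]
    intro j hj
    simp only [NatExpr.eval, RealExpr.eval, State.setNat_realArr, State.putReal_realArr, if_true,
      (hFυ.natVar Reg.square rfl).trans hi, hυ, hFυ.realArr RealArr.offset rfl,
      Function.update_apply]
    split_ifs with hji
    · rw [hji, Instance.relCornerX]
    · exact hτ j (by omega)
  · simp only [NatExpr.cost]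
    omega

theorem holds_passedTest_iff {j q : ℕ} (h : HasInput I σ) (hj : σ.natVar Reg.square = j)
    (hq : σ.natVar Reg.point = q)
    (hoffj : σ.realArr RealArr.offset j = offset K (I.relCornerX j))
    (hoffq : σ.realVar RealReg.offset = offset K (I.relPointX q)) :
    passedTest.Holds σ ↔ sweepKey K (I.relCornerX j) ≤ sweepKey K (I.relPointX q) := by
  simp only [passedTest, holds_boolOr, BoolExpr.Holds, RealExpr.eval, NatExpr.eval, hj, hq, hoffj,
    hoffq, h.pointX_eq, h.cornerX_eq, sweepKey, Prod.Lex.toLex_le_toLex, neg_le_neg_iff, not_le,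
    Instance.relPointX, Instance.relCornerX, sub_le_sub_iff_right]
  constructor
  · rintro (hlt | ⟨hle, hx⟩)
    · exact Or.inl hlt
    · exact hle.lt_or_eq.imp_right fun heq => ⟨heq, hx⟩
  · rintro (hlt | ⟨heq, hx⟩)
    · exact Or.inl hlt
    · exact Or.inr ⟨heq.le, hx⟩

theorem computeCut_spec {q : ℕ} (h : HasInput I σ)
    (hoff : ∀ j < I.m, σ.realArr RealArr.offset j = offset K (I.relCornerX j))
    (hq : σ.natVar Reg.point = q) (hmY : I.m ≤ Y) (hY : 1 ≤ Y) :
    Within (computeCut K) ((2 + (2 * K + 2) * 40) + (Y * 55 + 3)) σ fun τ =>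
      τ.natArr NatArr.cut = Function.update (σ.natArr NatArr.cut) q (I.cut K q) := by
  refine Within.bind (computeOffset_spec (x := I.pointX q) h ?_) fun τ hF hτ =>
    Within.bind (Within.time_mono (countIf_spec (fun j =>
      sweepKey K (I.relCornerX j) ≤ sweepKey K (I.relPointX q)) (by simp)
      (h.frame hF).numSquares_eq hmY hY fun j hj υ hFυ hυ => ?_) (Nat.mul_le_mul_left _ ?_))
      fun υ hFυ hυ => Within.putNat (i := .var Reg.point) (e := .var Reg.countPred) ?_
  · simp [RealExpr.eval, NatExpr.eval, hq, h.pointX_eq]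
  · exact holds_passedTest_iff ((h.frame hF).frame hFυ) hυ
      ((hFυ.natVar _ rfl).trans ((hF.natVar _ rfl).trans hq))
      (by rw [hFυ.realArr _ rfl, hF.realArr _ rfl, hoff j hj])
      ((hFυ.realVar _ rfl).trans hτ)
  · simp [passedTest, boolOr, BoolExpr.cost, RealExpr.cost, NatExpr.cost]
  · simp only [NatExpr.eval, State.putNat_natArr, if_true, hυ, Instance.cut,
      (hFυ.natVar Reg.point rfl).trans ((hF.natVar _ rfl).trans hq), hFυ.natArr NatArr.cut rfl,
      hF.natArr NatArr.cut rfl]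

theorem computeCuts_spec (h : HasInput I σ)
    (hoff : ∀ j < I.m, σ.realArr RealArr.offset j = offset K (I.relCornerX j))
    (hmY : I.m ≤ Y) (hY : 1 ≤ Y) :
    Within (computeCuts K) ((I.n + 1) * (Y * ((K + 1) * 170))) σ (Prepared I K) := by
  suffices hcuts : Within (computeCuts K) ((I.n + 1) * (Y * ((K + 1) * 170))) σ
      fun τ => ∀ q < I.n, τ.natArr NatArr.cut q = I.cut K q from
    hcuts.imp le_rfl fun τ hF hτ => ⟨h.frame hF, hτ⟩
  refine Within.time_mono (Within.forLoop (T := (2 + (2 * K + 2) * 40) + (Y * 55 + 3))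
    (fun i τ => ∀ q < i, τ.natArr NatArr.cut q = I.cut K q) rfl (Nat.le_succ I.n) (by omega)
    (fun τ hF => (h.frame hF).numPoints_eq) (by simp) fun i τ _ hF hi hτ => ?_)
    (Nat.mul_le_mul_left _ ?_)
  · refine (computeCut_spec (h.frame hF) ?_ hi hmY hY).imp le_rfl fun υ _ hυ q hq => ?_
    · simpa only [hF.realArr RealArr.offset rfl] using hoff
    rw [State.setNat_natArr, hυ, Function.update_apply]
    split_ifs with hqi
    · rw [hqi]
    · exact hτ q (by omega)
  · simp only [NatExpr.cost]
    nlinarith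

theorem multiplyNodes_spec {N m : ℕ} (hm : σ.natVar Reg.numSquares = m)
    (hN : σ.natVar Reg.numNodes = N) (hmY : m + 1 ≤ Y) :
    Within multiplyNodes (2 + (Y * (4 + 16 + 2 * 3) + 2)) σ fun τ =>
      τ.natVar Reg.numNodes = N * (m + 1) := by
  refine Within.seq (Within.setNat (Within.bind (Within.forLoop (T := 4)
    (fun i τ => τ.natVar Reg.product = N * i) rfl hmY (by omega) (fun τ hF => ?_) ?_
    fun i τ _ hF _ hτ =>
      Within.setNat (e := .add (.var Reg.product) (.var Reg.numNodes)) ?_)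
    fun τ _ hτ => Within.setNat (e := .var Reg.product) ?_))
  · simp [NatExpr.eval, hF.natVar Reg.numSquares rfl, hm]
  · simp [NatExpr.eval]
  · simp [NatExpr.eval, hF.natVar Reg.numNodes rfl, hN, hτ, mul_add]
  · simp [NatExpr.eval, hτ]

theorem countNodes_spec {m : ℕ} (hm : σ.natVar Reg.numSquares = m) (hmY : m + 1 ≤ Y) :
    Within (countNodes L) (Y * ((L + 1) * 60)) σ fun τ =>
      τ.natVar Reg.numNodes = (m + 1) ^ (L + 1) := by
  refine Within.time_mono (Within.seq (Within.setNat (Within.forLoop (Y := L + 1)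
    (T := 2 + (Y * (4 + 16 + 2 * 3) + 2)) (fun i τ => τ.natVar Reg.numNodes = (m + 1) ^ i) rfl
    le_rfl (by omega) (fun _ _ => rfl) ?_ fun i τ _ hF _ hτ => ?_))) ?_
  · simp [NatExpr.eval]
  · refine (multiplyNodes_spec ((hF.natVar Reg.numSquares rfl).trans hm) hτ hmY).imp le_rfl ?_
    rintro υ - hυ
    simpa [pow_succ] using hυ
  · simp only [NatExpr.cost]
    nlinarith [Nat.le_mul_of_pos_left (L + 1) (by omega : 0 < Y)]

theorem prepare_spec (h : HasInput I σ) (hmY : I.m + 1 ≤ Y) :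
    Within (prepare K L) ((I.n + 1) * Y * ((K + L + 1) * 340)) σ fun τ =>
      Prepared I K τ ∧ τ.natVar Reg.numNodes = (I.m + 1) ^ (L + 1) := by
  refine Within.time_mono (Within.bind (computeOffsets_spec (Y := Y) h (by omega) (by omega))
    fun τ hF hτ => Within.bind
      (computeCuts_spec (Y := Y) (h.frame hF) hτ (by omega) (by omega))
    fun υ _ hυ => (countNodes_spec hυ.numSquares_eq hmY).imp le_rfl
    fun χ hFχ hχ => ⟨hυ.frame hFχ, hχ⟩) ?_
  nlinarith [Nat.zero_le (I.n * Y * L), Nat.zero_le (I.n * Y), Nat.zero_le (I.n * Y * K)]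

end Preparation

/-! ### The dynamic program -/

/-- The memory of `σ` is prepared, and the node `s` is decoded as the current node, with its
validity and value. -/
structure NodeChecked (I : Instance) (K L s : ℕ) (σ : State) : Prop
    extends NodeLoaded I K L s σ where
  node_eq : σ.natVar Reg.node = s
  valid_iff : σ.natVar Reg.valid = 1 ↔ (I.network K L).Valid s
  value_eq : σ.natVar Reg.value = (I.network K L).value s

/-- The cells on which `NodeChecked` depends. -/
def checkedCells : List Cell :=
  .natVar Reg.node :: .natVar Reg.valid :: .natVar Reg.value :: nodeCells

/-- Replace the current entry by the one obtained from the candidate predecessor if that is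
better. -/
def relax : Program :=
  .cond
    (.and (.and (natEq (.var Reg.valid) (.const 1)) (natEq (.var Reg.edge) (.const 1)))
      (.and (.natLe (.const 1) (.get NatArr.best (.var Reg.pred)))
        (natLt (.var Reg.bestEntry)
          (.add (.get NatArr.best (.var Reg.pred)) (.var Reg.value)))))
    (.seq
      (.setNat Reg.bestEntry (.add (.get NatArr.best (.var Reg.pred)) (.var Reg.value)))
      (.setNat Reg.prevEntry (.var Reg.pred)))
    .skip

/-- Take the candidate predecessor into account in the entry of the current node. -/
def tryPredecessor (L : ℕ) : Program :=
  .seq (decode L Reg.pred NatArr.predSet Reg.predLayer) (.seq checkEdge relax)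

/-- Decode and check the current node. -/
def loadNode (L : ℕ) : Program :=
  .seq (decode L Reg.node NatArr.nodeSet Reg.layer) checkNode

/-- The entry of the current node that accounts only for the path without an edge. -/
def startEntry : Program :=
  .cond (.and (natEq (.var Reg.valid) (.const 1)) (natEq (.var Reg.layer) (.const 0)))
    (.setNat Reg.bestEntry (.add (.var Reg.value) (.const 1)))
    (.setNat Reg.bestEntry (.const 0))

/-- Write the entry of the current node into the tables. -/
def storeEntry : Program :=
  .seq (.putNat NatArr.best (.var Reg.node) (.var Reg.bestEntry))
    (.putNat NatArr.prev (.var Reg.node) (.var Reg.prevEntry))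

/-- Compute the entry of the current node. -/
def fillEntry (L : ℕ) : Program :=
  .seq (loadNode L) <|
  .seq startEntry <|
  .seq (.forLoop Reg.pred (.var Reg.node) (tryPredecessor L)) storeEntry

/-- Compute the tables of maximal values and of predecessors. -/
def fillTables (L : ℕ) : Program :=
  .forLoop Reg.node (.var Reg.numNodes) (fillEntry L)

section Tables

variable {I : Instance} {K L s t Y : ℕ} {σ τ : State} {p : Program}

theorem NodeChecked.frame (h : NodeChecked I K L s σ) (hF : Frame p σ τ)
    (hp : p.preserves checkedCells := by rfl) : NodeChecked I K L s τ := by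
  simp only [checkedCells, Program.preserves_cons] at hp
  obtain ⟨hnode, hvalid, hvalue, hp⟩ := hp
  exact ⟨h.toNodeLoaded.frame hF hp, (hF.natVar _ hnode).trans h.node_eq,
    by simpa only [hF.natVar _ hvalid] using h.valid_iff, (hF.natVar _ hvalue).trans h.value_eq⟩

theorem relax_spec (h : NodeChecked I K L s σ) (ht : σ.natVar Reg.pred = t) (hts : t < s)
    (hedge : σ.natVar Reg.edge = 1 ↔ (I.network K L).Edge t s)
    (hentry : (I.network K L).IsBestEntry (σ.natArr NatArr.best) s t
      (σ.natVar Reg.bestEntry) (σ.natVar Reg.prevEntry)) :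
    Within relax 40 σ fun τ => (I.network K L).IsBestEntry (σ.natArr NatArr.best) s (t + 1)
      (τ.natVar Reg.bestEntry) (τ.natVar Reg.prevEntry) := by
  refine Within.time_mono (Within.cond
    (fun hb => Within.seq (Within.setNat (Within.setNat ?_))) fun hb => Within.skip ?_) ?_
  · simp only [BoolExpr.Holds, holds_natEq, holds_natLt, NatExpr.eval, ht, h.valid_iff, hedge,
      h.value_eq] at hb
    obtain ⟨⟨hv, he⟩, h0, hlt⟩ := hb
    simpa [NatExpr.eval, ht, h.value_eq] using
      hentry.improve hts hv he (Nat.one_le_iff_ne_zero.1 h0) hlt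
  · simp only [BoolExpr.Holds, holds_natEq, holds_natLt, NatExpr.eval, ht, h.valid_iff, hedge,
      h.value_eq] at hb
    exact hentry.keep fun hv he h0 =>
      not_lt.1 fun hlt => hb ⟨⟨hv, he⟩, Nat.one_le_iff_ne_zero.2 h0, hlt⟩
  · simp [natEq, natLt, BoolExpr.cost, NatExpr.cost]

theorem tryPredecessor_spec (h : NodeChecked I K L s σ) (ht : σ.natVar Reg.pred = t)
    (hts : t < s) (hsY : s ≤ Y) (hmY : I.m ≤ Y)
    (hentry : (I.network K L).IsBestEntry (σ.natArr NatArr.best) s t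
      (σ.natVar Reg.bestEntry) (σ.natVar Reg.prevEntry)) :
    Within (tryPredecessor L) ((I.n + 1) * (Y * (L + 1)) * 440) σ fun τ =>
      (I.network K L).IsBestEntry (σ.natArr NatArr.best) s (t + 1)
        (τ.natVar Reg.bestEntry) (τ.natVar Reg.prevEntry) := by
  refine Within.time_mono (Within.bind
    (decode_spec h.toHasInput (by simp) ht (hts.trans_le hsY) hmY) fun τ hF hτ =>
    Within.bind (U := 40) (checkEdge_spec (t := t) (s := s) (Y := Y)
      ⟨(h.frame hF).toNodeLoaded, hτ.2, hτ.1⟩ hmY (by omega)) fun υ hFυ hυ => ?_) ?_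
  · have hbest : υ.natArr NatArr.best = σ.natArr NatArr.best :=
      (hFυ.natArr _ rfl).trans (hF.natArr _ rfl)
    rw [← hbest]
    refine relax_spec ((h.frame hF).frame hFυ)
      ((hFυ.natVar _ rfl).trans ((hF.natVar _ rfl).trans ht)) hts hυ ?_
    rwa [hbest, hFυ.natVar _ rfl, hF.natVar Reg.bestEntry rfl, hFυ.natVar _ rfl,
      hF.natVar Reg.prevEntry rfl]
  · have hdecode : Y * (L + 1) ≤ (I.n + 1) * (Y * (L + 1)) :=
      Nat.le_mul_of_pos_left _ (by omega)
    have hcheck : (I.n + 1) * Y ≤ (I.n + 1) * Y * (L + 1) := Nat.le_mul_of_pos_right _ (by omega)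
    have hone : 1 ≤ (I.n + 1) * (Y * (L + 1)) :=
      Nat.mul_pos (by omega) (Nat.mul_pos (by omega) (by omega))
    nlinarith

theorem loadNode_spec (h : Prepared I K σ) (hs : σ.natVar Reg.node = s) (hsY : s < Y)
    (hmY : I.m ≤ Y) :
    Within (loadNode L) ((I.n + 1) * (Y * (L + 1)) * 230) σ (NodeChecked I K L s) := by
  refine Within.time_mono (Within.bind (decode_spec h.toHasInput (by simp) hs hsY hmY)
    fun τ hF hτ => ?_) ?_ (T := Y * ((L + 1) * 90) + (I.n + 1) * (Y * 140))
  · have hload : NodeLoaded I K L s τ := ⟨h.frame hF, hτ.2, hτ.1⟩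
    exact (checkNode_spec hload hmY (by omega)).imp le_rfl fun υ hFυ hυ =>
      ⟨hload.frame hFυ, (hFυ.natVar _ rfl).trans ((hF.natVar _ rfl).trans hs), hυ.1, hυ.2⟩
  · have hdecode : Y * (L + 1) ≤ (I.n + 1) * (Y * (L + 1)) :=
      Nat.le_mul_of_pos_left _ (by omega)
    have hcheck : (I.n + 1) * Y ≤ (I.n + 1) * Y * (L + 1) := Nat.le_mul_of_pos_right _ (by omega)
    nlinarith

theorem startEntry_spec (h : NodeChecked I K L s σ) (best : ℕ → ℕ) :
    Within startEntry 22 σ fun τ =>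
      (I.network K L).IsBestEntry best s 0 (τ.natVar Reg.bestEntry) (τ.natVar Reg.prevEntry) := by
  refine Within.time_mono (Within.cond
    (fun hb => Within.setNat ?_) fun hb => Within.setNat ?_) ?_
  · simp only [BoolExpr.Holds, holds_natEq, NatExpr.eval, h.valid_iff, h.layer_eq] at hb
    simpa [NatExpr.eval, h.value_eq] using Network.isBestEntry_start hb.1 hb.2
  · simp only [BoolExpr.Holds, holds_natEq, NatExpr.eval, h.valid_iff, h.layer_eq] at hb
    simpa [NatExpr.eval] using Network.isBestEntry_none hb
  · simp [natEq, BoolExpr.cost, NatExpr.cost]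

theorem storeEntry_spec (hs : σ.natVar Reg.node = s)
    (htable : ∀ t < s, (I.network K L).TableAt (σ.natArr NatArr.best) (σ.natArr NatArr.prev) t)
    (hentry : (I.network K L).IsBestEntry (σ.natArr NatArr.best) s s
      (σ.natVar Reg.bestEntry) (σ.natVar Reg.prevEntry)) :
    Within storeEntry 6 σ fun τ => ∀ t < s + 1,
      (I.network K L).TableAt (τ.natArr NatArr.best) (τ.natArr NatArr.prev) t := by
  refine Within.seq (Within.putNat (i := .var Reg.node) (e := .var Reg.bestEntry)
    (Within.putNat (i := .var Reg.node) (e := .var Reg.prevEntry) fun t ht => ?_))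
  simp only [NatExpr.eval, State.putNat_natVar, State.putNat_natArr, if_true, NatArr.best,
    NatArr.prev, Nat.reduceEqDiff, if_false, hs, Network.TableAt]
  have hbest : ∀ u < t, Function.update (σ.natArr NatArr.best) s (σ.natVar Reg.bestEntry) u =
      σ.natArr NatArr.best u := fun u hu => Function.update_of_ne (by omega) _ _
  rcases Nat.lt_succ_iff_lt_or_eq.1 ht with hts | rfl
  · rw [Function.update_of_ne hts.ne, Function.update_of_ne hts.ne]
    exact (htable t hts).congr hbest
  · rw [Function.update_self, Function.update_self]
    exact hentry.congr hbest

theorem improveEntry_spec (h : NodeChecked I K L s σ) (hsY : s < Y) (hmY : I.m ≤ Y)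
    (hentry : (I.network K L).IsBestEntry (σ.natArr NatArr.best) s 0
      (σ.natVar Reg.bestEntry) (σ.natVar Reg.prevEntry)) :
    Within (.forLoop Reg.pred (.var Reg.node) (tryPredecessor L))
      (Y * ((I.n + 1) * (Y * (L + 1)) * 440 + 18)) σ fun τ =>
      (I.network K L).IsBestEntry (σ.natArr NatArr.best) s s
        (τ.natVar Reg.bestEntry) (τ.natVar Reg.prevEntry) := by
  refine Within.time_mono (Within.forLoop (T := (I.n + 1) * (Y * (L + 1)) * 440)
    (fun t τ => (I.network K L).IsBestEntry (σ.natArr NatArr.best) s t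
      (τ.natVar Reg.bestEntry) (τ.natVar Reg.prevEntry)) rfl hsY.le (by omega)
    (fun τ hF => (h.frame hF).node_eq) (by simpa using hentry)
    fun t τ hts hF ht hτ => ?_) (Nat.mul_le_mul_left _ (by simp only [NatExpr.cost]; omega))
  simp only [← hF.natArr NatArr.best rfl] at hτ ⊢
  exact (tryPredecessor_spec (h.frame hF) ht hts hsY.le hmY hτ).imp le_rfl fun υ _ hυ => hυ

theorem fillEntry_spec (h : Prepared I K σ) (hs : σ.natVar Reg.node = s) (hsY : s < Y)
    (hmY : I.m ≤ Y)
    (htable : ∀ t < s, (I.network K L).TableAt (σ.natArr NatArr.best) (σ.natArr NatArr.prev) t) :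
    Within (fillEntry L) (Y * ((I.n + 1) * (Y * (L + 1)) * 730)) σ fun τ =>
      ∀ t < s + 1,
        (I.network K L).TableAt (τ.natArr NatArr.best) (τ.natArr NatArr.prev) t := by
  refine Within.time_mono (Within.bind (loadNode_spec (L := L) h hs hsY hmY) fun τ hF hτ =>
    Within.bind (startEntry_spec hτ (τ.natArr NatArr.best)) fun υ hFυ hυ =>
    Within.bind (improveEntry_spec (hτ.frame hFυ) hsY hmY (hFυ.natArr NatArr.best rfl ▸ hυ))
      fun χ hFχ hχ => storeEntry_spec (((hτ.frame hFυ).frame hFχ).node_eq) ?_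
        (hFχ.natArr NatArr.best rfl ▸ hχ)) ?_
  · rwa [hFχ.natArr _ rfl, hFυ.natArr _ rfl, hF.natArr NatArr.best rfl, hFχ.natArr _ rfl,
      hFυ.natArr _ rfl, hF.natArr NatArr.prev rfl]
  · have hone : 1 ≤ (I.n + 1) * (Y * (L + 1)) :=
      Nat.mul_pos (by omega) (Nat.mul_pos (by omega) (by omega))
    generalize (I.n + 1) * (Y * (L + 1)) = Z at hone ⊢
    nlinarith [Nat.le_mul_of_pos_left Z (by omega : 0 < Y), Nat.le_mul_of_pos_right Y hone]

theorem fillTables_spec (h : Prepared I K σ) (hY : σ.natVar Reg.numNodes = Y)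
    (hmY : I.m + 1 ≤ Y) :
    Within (fillTables L) (Y * (Y * ((I.n + 1) * (Y * (L + 1)) * 750))) σ fun τ =>
      ∀ s < Y, (I.network K L).TableAt (τ.natArr NatArr.best) (τ.natArr NatArr.prev) s := by
  refine Within.time_mono (Within.forLoop (T := Y * ((I.n + 1) * (Y * (L + 1)) * 730))
    (fun i τ => ∀ s < i,
      (I.network K L).TableAt (τ.natArr NatArr.best) (τ.natArr NatArr.prev) s)
    rfl le_rfl (by omega) (fun τ hF => (hF.natVar Reg.numNodes rfl).trans hY) (by simp)
    fun s τ hsY hF hs hτ => ?_) (Nat.mul_le_mul_left _ ?_)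
  · exact (fillEntry_spec (h.frame hF) hs hsY (by omega) hτ).imp le_rfl fun υ _ hυ => hυ
  · have hone : 1 ≤ Y * ((I.n + 1) * (Y * (L + 1))) :=
      Nat.mul_pos (by omega) (Nat.mul_pos (by omega) (Nat.mul_pos (by omega) (by omega)))
    simp only [NatExpr.cost]
    linarith

end Tables

/-! ### The best path -/

/-- `b` is the largest entry of the table `best` among the indices below `i` in layer `l`, or `0`
if there is none, and it is attained at `t` unless it is `0`. -/
structure IsMaxEntry (layer best : ℕ → ℕ) (l i b t : ℕ) : Prop where
  attained : b ≠ 0 → t < i ∧ layer t = l ∧ best t = b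
  le : ∀ s < i, layer s = l → best s ≤ b

/-- Replace the current entry by that of the current node if that node lies in the last layer and
its entry is larger. -/
def examineNode (L : ℕ) : Program :=
  .seq (decode L Reg.node NatArr.nodeSet Reg.layer) <|
  .cond
    (.and (natEq (.var Reg.layer) (.var Reg.numSquares))
      (natLt (.var Reg.bestEntry) (.get NatArr.best (.var Reg.node))))
    (.seq (.setNat Reg.bestEntry (.get NatArr.best (.var Reg.node)))
      (.setNat Reg.prevEntry (.var Reg.node)))
    .skip

/-- Find the largest entry of the table of maximal values in the last layer. -/
def findBest (L : ℕ) : Program :=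
  .seq (.setNat Reg.bestEntry (.const 0)) <|
  .forLoop Reg.node (.var Reg.numNodes) (examineNode L)

/-- Select the squares in the set of the current node. -/
def markMembers : Program :=
  .forLoop Reg.square (.var Reg.numSquares) <|
  .cond (memTest NatArr.nodeSet) (.putNat NatArr.selected (.var Reg.square) (.const 1)) .skip

/-- Select the squares in the sets along the path that ends in the node `Reg.prevEntry`. -/
def tracePath (L : ℕ) : Program :=
  .forLoop Reg.counter (.add (.var Reg.numSquares) (.const 1)) <|
  .seq (decode L Reg.prevEntry NatArr.nodeSet Reg.layer) <|
  .seq markMembers (.setNat Reg.prevEntry (.get NatArr.prev (.var Reg.prevEntry)))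

section BestPath

variable {I : Instance} {K L l i b s t Y : ℕ} {layer best prev : ℕ → ℕ} {σ : State}

theorem IsMaxEntry.improve (h : IsMaxEntry layer best l i b t) (hi : layer i = l)
    (hb : b < best i) : IsMaxEntry layer best l (i + 1) (best i) i :=
  ⟨fun _ => ⟨i.lt_succ_self, hi, rfl⟩, Nat.forall_lt_succ_right.2
    ⟨fun s hs hl => (h.le s hs hl).trans hb.le, fun _ => le_rfl⟩⟩

theorem IsMaxEntry.keep (h : IsMaxEntry layer best l i b t) (hb : layer i = l → best i ≤ b) :
    IsMaxEntry layer best l (i + 1) b t :=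
  ⟨fun h0 => (h.attained h0).imp_left Nat.lt_succ_of_lt, Nat.forall_lt_succ_right.2 ⟨h.le, hb⟩⟩

theorem examineNode_spec (h : HasInput I σ) (hs : σ.natVar Reg.node = s) (hsY : s < Y)
    (hmY : I.m ≤ Y)
    (hmax : IsMaxEntry (I.network K L).layer (σ.natArr NatArr.best) I.m s
      (σ.natVar Reg.bestEntry) (σ.natVar Reg.prevEntry)) :
    Within (examineNode L) (Y * ((L + 1) * 90) + 30) σ fun τ =>
      IsMaxEntry (I.network K L).layer (σ.natArr NatArr.best) I.m (s + 1)
        (τ.natVar Reg.bestEntry) (τ.natVar Reg.prevEntry) := by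
  refine Within.bind (decode_spec h (by simp) hs hsY hmY) fun τ hF hτ => Within.time_mono
    (Within.cond (fun hb => Within.seq (Within.setNat (Within.setNat ?_)))
      fun hb => Within.skip ?_) (by simp [natEq, natLt, BoolExpr.cost, NatExpr.cost])
  · simp only [BoolExpr.Holds, holds_natEq, holds_natLt, NatExpr.eval, hτ.2,
      (h.frame hF).numSquares_eq, hF.natArr NatArr.best rfl, hF.natVar Reg.bestEntry rfl,
      (hF.natVar Reg.node rfl).trans hs] at hb
    simpa [NatExpr.eval, hF.natArr NatArr.best rfl, (hF.natVar Reg.node rfl).trans hs] using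
      hmax.improve hb.1 hb.2
  · simp only [BoolExpr.Holds, holds_natEq, holds_natLt, NatExpr.eval, hτ.2,
      (h.frame hF).numSquares_eq, hF.natArr NatArr.best rfl, hF.natVar Reg.bestEntry rfl,
      (hF.natVar Reg.node rfl).trans hs] at hb
    rw [hF.natVar Reg.bestEntry rfl, hF.natVar Reg.prevEntry rfl]
    exact hmax.keep fun hl => not_lt.1 fun hlt => hb ⟨hl, hlt⟩

theorem findBest_spec (h : HasInput I σ) (hY : σ.natVar Reg.numNodes = Y) (hmY : I.m + 1 ≤ Y) :
    Within (findBest L) (Y * (Y * ((L + 1) * 150))) σ fun τ =>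
      IsMaxEntry (I.network K L).layer (σ.natArr NatArr.best) I.m Y
        (τ.natVar Reg.bestEntry) (τ.natVar Reg.prevEntry) := by
  refine Within.time_mono (Within.bind (Within.setNat (Q := fun τ => τ.natVar Reg.bestEntry = 0)
    (by simp [NatExpr.eval])) fun υ hFυ hυ => Within.forLoop (T := Y * ((L + 1) * 90) + 30)
    (fun i τ => IsMaxEntry (I.network K L).layer (σ.natArr NatArr.best) I.m i
      (τ.natVar Reg.bestEntry) (τ.natVar Reg.prevEntry)) rfl le_rfl (by omega)
    (fun τ hF => (hF.natVar Reg.numNodes rfl).trans ((hFυ.natVar _ rfl).trans hY))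
    ⟨by simp [hυ], by simp⟩
    fun i τ hiY hF hi hτ => ?_) ?_
  · simp only [← hFυ.natArr NatArr.best rfl, ← hF.natArr NatArr.best rfl] at hτ ⊢
    exact (examineNode_spec ((h.frame hFυ).frame hF) hi hiY (by omega) hτ).imp le_rfl
      fun χ _ hχ => hχ
  · have hY1 : Y ≤ Y * (Y * (L + 1)) :=
      Nat.le_mul_of_pos_right _ (Nat.mul_pos (by omega) (by omega))
    simp only [NatExpr.cost]
    nlinarith

theorem markMembers_spec {W : Finset ℕ} (h : HasInput I σ)
    (hW : Represents I.m NatArr.nodeSet σ W) (hmY : I.m ≤ Y) (hY : 1 ≤ Y) :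
    Within markMembers (Y * 30) σ fun τ => ∀ j < I.m,
      (τ.natArr NatArr.selected j = 1 ↔ σ.natArr NatArr.selected j = 1 ∨ j ∈ W) := by
  refine Within.time_mono (Within.imp (Within.forLoop (T := 9)
    (fun i τ => ∀ j, (τ.natArr NatArr.selected j = 1 ↔
      σ.natArr NatArr.selected j = 1 ∨ (j < i ∧ j ∈ W)))
    rfl hmY hY (fun τ hF => (h.frame hF).numSquares_eq) (by simp) fun i τ him hF hi hτ => ?_)
    le_rfl fun τ _ hτ j hj => by rw [hτ j, and_iff_right hj]) ?_
  · have hmem : (memTest NatArr.nodeSet).Holds τ ↔ i ∈ W :=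
      (hW.congr (hF.natArr _ rfl)).holds_memTest_iff him hi
    have hlt : ∀ j, (j < i + 1 ∧ j ∈ W) ↔ (j < i ∧ j ∈ W) ∨ (j = i ∧ i ∈ W) := by grind
    refine Within.time_mono (Within.cond
      (fun hb => Within.putNat (i := .var Reg.square) (e := .const 1) fun j => ?_)
      fun hb => Within.skip fun j => ?_) (by simp [memTest, BoolExpr.cost, NatExpr.cost])
    · rw [hlt, ← or_assoc, ← hτ j]
      by_cases hj : j = i <;> simp [NatExpr.eval, hi, hmem.1 hb, hj]
    · rw [hlt, ← or_assoc, ← hτ j]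
      simp [mt hmem.2 hb]
  · simp only [NatExpr.cost]
    omega

theorem tracePath_spec (h : HasInput I σ) (hs : σ.natVar Reg.prevEntry = s)
    (hprev : σ.natArr NatArr.prev = prev) (hmY : I.m + 1 ≤ Y) (hlt : ∀ i ≤ I.m, prev^[i] s < Y)
    (h0 : ∀ j < I.m, σ.natArr NatArr.selected j = 0) :
    Within (tracePath L) (Y * (Y * ((L + 1) * 150))) σ fun τ => ∀ j < I.m,
      (τ.natArr NatArr.selected j = 1 ↔ j ∈ (I.network K L).traceSet prev I.m s) := by
  refine Within.time_mono (Within.imp (Within.forLoop (T := Y * ((L + 1) * 90) + (Y * 30 + 3))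
    (fun i τ => τ.natVar Reg.prevEntry = prev^[i] s ∧ ∀ j < I.m,
      (τ.natArr NatArr.selected j = 1 ↔ ∃ u < i, j ∈ nodeSet I.m L (prev^[u] s)))
    rfl hmY (by omega) (fun τ hF => congrArg (· + 1) (h.frame hF).numSquares_eq)
    ⟨by simpa using hs, fun j hj => by simp [h0 j hj]⟩ ?_)
    le_rfl fun τ _ hτ j hj => ?_) (Nat.mul_le_mul_left _ ?_)
  · rintro i τ hi hF - ⟨hnode, hsel⟩
    refine Within.bind (decode_spec (h.frame hF) (by simp) hnode (hlt i (by omega)) (by omega))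
      fun υ hFυ hυ => Within.bind (markMembers_spec ((h.frame hF).frame hFυ) hυ.1 (by omega)
        (by omega)) fun χ hFχ hχ => Within.setNat
          (e := .get NatArr.prev (.var Reg.prevEntry)) ⟨?_, fun j hj => ?_⟩
    · simp only [NatExpr.eval, State.setNat_natVar, Reg.prevEntry, Reg.counter, if_true,
        Nat.reduceEqDiff, if_false, Function.iterate_succ_apply', hFχ.natArr NatArr.prev rfl,
        hFυ.natArr NatArr.prev rfl, hF.natArr NatArr.prev rfl, hprev,
        (hFχ.natVar Reg.prevEntry rfl).trans ((hFυ.natVar _ rfl).trans hnode)]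
    · rw [State.setNat_natArr, State.setNat_natArr, hχ j hj, hFυ.natArr _ rfl, hsel j hj]
      simp only [Nat.lt_succ_iff_lt_or_eq, or_and_right, exists_or, exists_eq_left]
  · rw [hτ.2 j hj]
    simp [Network.traceSet, Instance.network]
  · simp only [NatExpr.cost]
    nlinarith [Nat.le_mul_of_pos_right Y L.succ_pos, Nat.mul_pos (by omega : 0 < Y) L.succ_pos]

end BestPath

/-! ### The solver -/

/-- `S` is a set of squares, given by their indices, that covers all points. -/
def Instance.IsCover (I : Instance) (S : Finset ℕ) : Prop :=
  S ⊆ Finset.range I.m ∧ ∀ q < I.n, 1 ≤ depth I.Covers S q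

/-- `S` is a cover with the maximal number of uniquely covered points. -/
def Instance.IsOptimal (I : Instance) (S : Finset ℕ) : Prop :=
  I.IsCover S ∧ ∀ T, I.IsCover T →
    uniqueDepthCount I.Covers (Finset.range I.n) T ≤ uniqueDepthCount I.Covers (Finset.range I.n) S

/-- The indices below `m` of the squares that a state selects. -/
def selectedIndices (m : ℕ) (σ : State) : Finset ℕ :=
  (Finset.range m).filter fun j => σ.natArr NatArr.selected j = 1

/-- If there is a path through all layers, report it by setting the answer and selecting its
squares. -/
def reportPath (L : ℕ) : Program :=
  .cond (.natLe (.const 1) (.var Reg.bestEntry))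
    (.seq (.setNat Reg.answer (.const 1)) (tracePath L)) .skip

/-- The complete program for instances of extent at most `K`, with nodes that consist of at most `L`
squares. -/
def solver (K L : ℕ) : Program :=
  .seq (prepare K L) <| .seq (fillTables L) <| .seq (findBest L) (reportPath L)

section Solver

variable {I : Instance} {K L b t Y : ℕ} {best prev : ℕ → ℕ} {S : Finset ℕ} {σ : State}

theorem Instance.traceSet_network_subset (l s : ℕ) :
    (I.network K L).traceSet prev l s ⊆ Finset.range I.m :=
  Finset.biUnion_subset.2 fun _ _ => nodeSet_subset _ _ _

theorem IsMaxEntry.uniqueDepthCount_lt (hI : I.FitsIn K) (hL : 8 * (2 * K + 2) ^ 2 ≤ L)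
    (htable : ∀ s < (I.m + 1) ^ (L + 1), (I.network K L).TableAt best prev s)
    (hmax : IsMaxEntry (I.network K L).layer best I.m ((I.m + 1) ^ (L + 1)) b t)
    (hS : I.IsCover S) : uniqueDepthCount I.Covers (Finset.range I.n) S < b := by
  obtain ⟨s, hs, hl, hlt⟩ := I.exists_uniqueDepthCount_lt_best hI hL htable hS.1 hS.2
  exact hlt.trans_le (hmax.le s hs hl)

theorem IsMaxEntry.isOptimal_traceSet (hI : I.FitsIn K) (hL : 8 * (2 * K + 2) ^ 2 ≤ L)
    (htable : ∀ s < (I.m + 1) ^ (L + 1), (I.network K L).TableAt best prev s)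
    (hmax : IsMaxEntry (I.network K L).layer best I.m ((I.m + 1) ^ (L + 1)) b t) (hb : b ≠ 0) :
    I.IsOptimal ((I.network K L).traceSet prev I.m t) := by
  obtain ⟨ht, hl, rfl⟩ := hmax.attained hb
  refine ⟨⟨I.traceSet_network_subset _ _, fun q hq =>
    Network.one_le_depth_traceSet htable ht hb hl (Finset.mem_range.2 hq) I.cut_le⟩,
    fun T hT => Nat.le_of_lt_succ ?_⟩
  have hval := Network.best_eq_uniqueDepthCount_traceSet htable ht hb hl fun q _ => I.cut_le
  exact (hmax.uniqueDepthCount_lt hI hL htable hT).trans_eq hval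

theorem reportPath_spec (h : HasInput I σ) (hanswer : σ.natVar Reg.answer = 0)
    (hselected : ∀ j < I.m, σ.natArr NatArr.selected j = 0)
    (hprev : σ.natArr NatArr.prev = prev) (hmY : I.m + 1 ≤ Y)
    (hlt : σ.natVar Reg.bestEntry ≠ 0 → ∀ i ≤ I.m, prev^[i] (σ.natVar Reg.prevEntry) < Y) :
    Within (reportPath L) (10 + Y * (Y * ((L + 1) * 150))) σ fun τ =>
      (σ.natVar Reg.bestEntry ≠ 0 → τ.natVar Reg.answer = 1 ∧ selectedIndices I.m τ =
        (I.network K L).traceSet prev I.m (σ.natVar Reg.prevEntry)) ∧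
      (σ.natVar Reg.bestEntry = 0 → τ.natVar Reg.answer = 0) := by
  have hholds : (BoolExpr.natLe (.const 1) (.var Reg.bestEntry)).Holds σ ↔
      σ.natVar Reg.bestEntry ≠ 0 := Nat.one_le_iff_ne_zero
  refine Within.time_mono (Within.cond (T := 2 + Y * (Y * ((L + 1) * 150))) (fun hb => ?_)
    fun hb => Within.skip ?_) ?_
  · refine Within.bind (Within.setNat (Q := fun τ => τ.natVar Reg.answer = 1) rfl)
      fun υ hυ hans => (tracePath_spec (K := K) (h.frame hυ) (hυ.natVar Reg.prevEntry rfl)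
        ((hυ.natArr _ rfl).trans hprev) hmY (hlt (hholds.1 hb))
        (by simpa only [hυ.natArr _ rfl] using hselected)).imp le_rfl fun τ hτ hsel =>
      ⟨fun _ => ⟨(hτ.natVar Reg.answer rfl).trans hans, ?_⟩,
        fun h0 => absurd h0 (hholds.1 hb)⟩
    rw [selectedIndices, Finset.filter_congr fun j hj => hsel j (Finset.mem_range.1 hj),
      Finset.filter_mem_eq_inter,
      Finset.inter_eq_right.2 (I.traceSet_network_subset I.m (σ.natVar Reg.prevEntry))]
  · rw [hholds, not_not] at hb
    exact ⟨fun hne => absurd hb hne, fun _ => hanswer⟩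
  · simp only [BoolExpr.cost, NatExpr.cost]
    omega

theorem solver_time_le (n K L : ℕ) (hY : 1 ≤ Y) :
    (n + 1) * Y * ((K + L + 1) * 340) + (Y * (Y * ((n + 1) * (Y * (L + 1)) * 750)) +
      (Y * (Y * ((L + 1) * 150)) + (10 + Y * (Y * ((L + 1) * 150))))) ≤
    (K + L + 1) * 1500 * ((n + 1) * (Y * (Y * Y))) := by
  have hYY : 1 ≤ Y * Y := Nat.mul_pos hY hY
  calc
    _ = (n + 1) * (1 * Y * 1) * ((K + L + 1) * 340) + ((n + 1) * (Y * (Y * Y)) * ((L + 1) * 750) +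
        (1 * (1 * (Y * Y)) * ((L + 1) * 300) + 1 * (1 * (1 * 1)) * 10)) := by ring
    _ ≤ (n + 1) * (Y * Y * Y) * ((K + L + 1) * 340) +
        ((n + 1) * (Y * (Y * Y)) * ((K + L + 1) * 750) +
        ((n + 1) * (Y * (Y * Y)) * ((K + L + 1) * 300) +
          (n + 1) * (Y * (Y * Y)) * ((K + L + 1) * 110))) := by
      gcongr <;> omega
    _ = _ := by ring

theorem solver_spec (h : HasInput I σ) (hanswer : σ.natVar Reg.answer = 0)
    (hselected : ∀ j < I.m, σ.natArr NatArr.selected j = 0) (hI : I.FitsIn K)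
    (hL : 8 * (2 * K + 2) ^ 2 ≤ L) :
    Within (solver K L) ((K + L + 1) * 1500 * ((I.n + 1) * (I.m + 1) ^ (3 * (L + 1)))) σ fun τ =>
      ((∃ S, I.IsCover S) → τ.natVar Reg.answer = 1 ∧ I.IsOptimal (selectedIndices I.m τ)) ∧
      ((¬ ∃ S, I.IsCover S) → τ.natVar Reg.answer = 0) := by
  have hmY : I.m + 1 ≤ (I.m + 1) ^ (L + 1) := Nat.le_self_pow (by omega) _
  rw [show (I.m + 1) ^ (3 * (L + 1)) =
    (I.m + 1) ^ (L + 1) * ((I.m + 1) ^ (L + 1) * (I.m + 1) ^ (L + 1)) by ring]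
  refine Within.time_mono (Within.bind (prepare_spec h hmY) fun σ₁ h₁ ⟨hprep, hnodes⟩ =>
    Within.bind (fillTables_spec hprep hnodes hmY) fun σ₂ h₂ htable =>
    Within.bind (findBest_spec (K := K) (hprep.toHasInput.frame h₂)
      ((h₂.natVar Reg.numNodes rfl).trans hnodes) hmY) fun σ₃ h₃ hmax =>
    (reportPath_spec (K := K) ((hprep.toHasInput.frame h₂).frame h₃)
      (((h₃.natVar _ rfl).trans (h₂.natVar _ rfl)).trans ((h₁.natVar _ rfl).trans hanswer))
      (fun j hj => ?_) (h₃.natArr _ rfl) hmY fun hb i hi => ?_).imp le_rfl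
      fun τ _ ⟨hyes, hno⟩ => ⟨fun ⟨S, hS⟩ => ?_, fun hn => hno ?_⟩)
    (solver_time_le I.n K L (by omega))
  · rw [h₃.natArr _ rfl, h₂.natArr _ rfl, h₁.natArr _ rfl, hselected j hj]
  · obtain ⟨hs, hl, hbest⟩ := hmax.attained hb
    exact (Network.iterate_prev_spec htable hs (hbest ▸ hb) (hl.symm ▸ hi)).1
  · have hb := (hmax.uniqueDepthCount_lt hI hL htable hS).ne_bot
    obtain ⟨hans, hsel⟩ := hyes hb
    exact ⟨hans, hsel ▸ hmax.isOptimal_traceSet hI hL htable hb⟩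
  · by_contra hb
    exact hn ⟨_, (hmax.isOptimal_traceSet hI hL htable hb).1⟩

end Solver

/-! ### Squares and their indices -/

/-- The instance that the initial state for the points `p` and the squares `d` holds. -/
noncomputable def Instance.ofInput {n m : ℕ} (p : Fin n → ℝ × ℝ) (d : Fin m → ℝ × ℝ) :
    Instance where
  n := n
  m := m
  pointX := toArray fun i => (p i).1
  pointY := toArray fun i => (p i).2
  cornerX := toArray fun j => (d j).1
  cornerY := toArray fun j => (d j).2

/-- The set of lower-left corners of the squares with indices in `J`. -/
noncomputable def corners {m : ℕ} (d : Fin m → ℝ × ℝ) (J : Finset ℕ) : Finset (ℝ × ℝ) :=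
  (Finset.univ.filter fun j : Fin m => (j : ℕ) ∈ J).image d

theorem card_filter_of_subset_range {m : ℕ} {J : Finset ℕ} (hJ : J ⊆ Finset.range m)
    (P : ℕ → Prop) [DecidablePred P] :
    (J.filter P).card = (Finset.univ.filter fun j : Fin m => (j : ℕ) ∈ J ∧ P j).card := by
  rw [← Finset.card_map Fin.valEmbedding]
  congr 1
  ext j
  simp only [Finset.mem_filter, Finset.mem_map, Finset.mem_univ, true_and, Fin.valEmbedding_apply]
  exact ⟨fun h => ⟨⟨j, Finset.mem_range.1 (hJ h.1)⟩, h, rfl⟩, by rintro ⟨i, h, rfl⟩; exact h⟩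

section Input

variable {n m : ℕ} (p : Fin n → ℝ × ℝ) (d : Fin m → ℝ × ℝ)

@[simp] theorem toArray_apply (f : Fin n → ℝ) (i : Fin n) : toArray f i = f i := by
  simp [toArray]

theorem hasInput_inputState : HasInput (Instance.ofInput p d) (inputState p d) :=
  ⟨by simp [inputState, Instance.ofInput], by simp [inputState, Instance.ofInput], rfl, rfl, rfl,
    rfl⟩

theorem covers_ofInput (j : Fin m) (q : Fin n) :
    (Instance.ofInput p d).Covers j q ↔ p q ∈ unitSquare (d j) := by
  simp only [Instance.Covers, Instance.ofInput, toArray_apply, unitSquare, Set.mem_Icc,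
    Prod.le_def, Prod.fst_add, Prod.snd_add]
  tauto

theorem fitsIn_ofInput {k : ℝ} {K : ℕ} (hkK : k ≤ K) {z : ℝ × ℝ}
    (hz : ∀ i, p i ∈ Set.Icc z (z + (k, k))) : (Instance.ofInput p d).FitsIn K := by
  intro q (hq : q < n)
  have hn : 0 < n := q.zero_le.trans_lt hq
  obtain ⟨⟨h₁, h₂⟩, h₃, h₄⟩ := hz ⟨q, hq⟩
  obtain ⟨⟨h₅, h₆⟩, h₇, h₈⟩ := hz ⟨0, hn⟩
  simp only [Prod.fst_add, Prod.snd_add] at h₃ h₄ h₇ h₈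
  simp only [Instance.relPointX, Instance.relPointY, Instance.ofInput, toArray,
    dif_pos hq, dif_pos hn, abs_le]
  refine ⟨⟨?_, ?_⟩, ?_, ?_⟩ <;> linarith

theorem exists_corners_eq {S : Finset (ℝ × ℝ)} (hS : S ⊆ Finset.univ.image d) :
    ∃ J ⊆ Finset.range m, corners d J = S := by
  classical
  obtain ⟨T, -, rfl⟩ := Finset.subset_image_iff.1 hS
  refine ⟨T.map Fin.valEmbedding, fun j hj => ?_, ?_⟩
  · obtain ⟨i, -, rfl⟩ := Finset.mem_map.1 hj
    exact Finset.mem_range.2 i.2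
  · simp [corners, Fin.val_inj]

theorem corners_selectedIndices (σ : State) : corners d (selectedIndices m σ) = σ.selected d := by
  simp [corners, State.selected, selectedIndices]

variable {d}

open Classical in
theorem depth_ofInput (hd : Function.Injective d) {J : Finset ℕ} (hJ : J ⊆ Finset.range m)
    (q : Fin n) : depth (Instance.ofInput p d).Covers J q =
      ((corners d J).filter fun c => p q ∈ unitSquare c).card := by
  rw [corners, Finset.filter_image, Finset.card_image_of_injective _ hd, Finset.filter_filter,
    depth, card_filter_of_subset_range hJ]
  simp only [covers_ofInput]

theorem isCover_corners_iff (hd : Function.Injective d) {J : Finset ℕ} (hJ : J ⊆ Finset.range m) :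
    IsCover (Finset.univ.image p) (Finset.univ.image d) (corners d J) ↔
      (Instance.ofInput p d).IsCover J := by
  classical
  have hsub : corners d J ⊆ Finset.univ.image d :=
    Finset.image_subset_image (Finset.filter_subset _ _)
  have hdepth (q : Fin n) : (∃ c ∈ corners d J, p q ∈ unitSquare c) ↔
      1 ≤ depth (Instance.ofInput p d).Covers J q := by
    rw [depth_ofInput p hd hJ, Finset.one_le_card, Finset.filter_nonempty_iff]
  simp only [IsCover, hsub, true_and, Finset.forall_mem_image, Finset.mem_univ, true_imp_iff,
    hdepth, Fin.forall_iff]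
  exact (and_iff_right hJ).symm

variable {p}

theorem uniqueCount_corners (hp : Function.Injective p) (hd : Function.Injective d) {J : Finset ℕ}
    (hJ : J ⊆ Finset.range m) : uniqueCount (Finset.univ.image p) (corners d J) =
      uniqueDepthCount (Instance.ofInput p d).Covers (Finset.range n) J := by
  classical
  have hdepth (q : Fin n) : (∃! c, c ∈ corners d J ∧ p q ∈ unitSquare c) ↔
      depth (Instance.ofInput p d).Covers J q = 1 := by
    rw [depth_ofInput p hd hJ, Finset.card_eq_one, Finset.singleton_iff_unique_mem]
    simp only [Finset.mem_filter]
  rw [uniqueCount, Finset.filter_image, Finset.card_image_of_injective _ hp, uniqueDepthCount,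
    card_filter_of_subset_range subset_rfl]
  simp only [hdepth, Finset.mem_range, Fin.is_lt, true_and]

theorem exists_isCover_iff (hd : Function.Injective d) :
    (∃ S, IsCover (Finset.univ.image p) (Finset.univ.image d) S) ↔
      ∃ J, (Instance.ofInput p d).IsCover J := by
  constructor
  · rintro ⟨S, hS⟩
    obtain ⟨J, hJ, rfl⟩ := exists_corners_eq d hS.1
    exact ⟨J, (isCover_corners_iff p hd hJ).1 hS⟩
  · rintro ⟨J, hJ⟩
    exact ⟨_, (isCover_corners_iff p hd hJ.1).2 hJ⟩

theorem isOptimal_corners (hp : Function.Injective p) (hd : Function.Injective d) {J : Finset ℕ}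
    (hJ : (Instance.ofInput p d).IsOptimal J) :
    IsOptimal (Finset.univ.image p) (Finset.univ.image d) (corners d J) := by
  obtain ⟨hcover, hmax⟩ := hJ
  refine ⟨(isCover_corners_iff p hd hcover.1).2 hcover, fun S hS => ?_⟩
  obtain ⟨J', hJ', rfl⟩ := exists_corners_eq d hS.1
  rw [uniqueCount_corners hp hd hJ', uniqueCount_corners hp hd hcover.1]
  exact hmax J' ((isCover_corners_iff p hd hJ').1 hS)

end Input

/-! ### The running time -/

theorem time_le_rpow {n m c e : ℕ} {E : ℝ} (he : (e : ℝ) ≤ E) :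
    ((c * ((n + 1) * (m + 1) ^ e) : ℕ) : ℝ) ≤
      (c * 2 * 2 ^ e : ℝ) * (max n 1 : ℕ) * ((max m 1 : ℕ) : ℝ) ^ E := by
  have hle : c * ((n + 1) * (m + 1) ^ e) ≤ c * ((2 * max n 1) * (2 * max m 1) ^ e) := by
    gcongr <;> omega
  have hrpow : ((max m 1 : ℕ) : ℝ) ^ e ≤ ((max m 1 : ℕ) : ℝ) ^ E := by
    rw [← Real.rpow_natCast]
    exact Real.rpow_le_rpow_of_exponent_le (mod_cast le_max_right m 1) he
  calc ((c * ((n + 1) * (m + 1) ^ e) : ℕ) : ℝ)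
      ≤ ((c * ((2 * max n 1) * (2 * max m 1) ^ e) : ℕ) : ℝ) := by exact_mod_cast hle
    _ = (c * 2 * 2 ^ e : ℝ) * (max n 1 : ℕ) * ((max m 1 : ℕ) : ℝ) ^ e := by
      simp only [Nat.cast_mul, Nat.cast_pow, Nat.cast_ofNat, mul_pow]
      ring
    _ ≤ _ := by gcongr

theorem exponent_le {k : ℝ} (hk : 1 ≤ k) :
    ((3 * (8 * (2 * ⌈k⌉₊ + 2) ^ 2 + 1) : ℕ) : ℝ) ≤ 867 * k ^ 2 := by
  have hceil : (⌈k⌉₊ : ℝ) < k + 1 := Nat.ceil_lt_add_one (by linarith)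
  have hsq : (2 * ⌈k⌉₊ + 2 : ℝ) ^ 2 ≤ (6 * k) ^ 2 := by gcongr; linarith
  have hone : 1 ≤ k ^ 2 := one_le_pow₀ hk
  push_cast
  linarith [mul_pow 6 k 2]

end UniqueSquareCover

open UniqueSquareCover in
theorem theorem3 :
    ∃ C : ℝ, ∀ k : ℝ, 1 ≤ k → ∃ (prog : Program) (A : ℝ),
      ∀ (n m : ℕ) (p : Fin n → ℝ × ℝ) (d : Fin m → ℝ × ℝ),
        Function.Injective p → Function.Injective d →
        (∃ z : ℝ × ℝ, ∀ i, p i ∈ Set.Icc z (z + (k, k))) →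
        ∃ (τ : State) (t : ℕ),
          Runs prog (inputState p d) τ t ∧
          (t : ℝ) ≤ A * (max n 1 : ℕ) * ((max m 1 : ℕ) : ℝ) ^ (C * k ^ 2) ∧
          ((∃ S, IsCover (Finset.univ.image p) (Finset.univ.image d) S) →
            τ.saysYes ∧
            IsOptimal (Finset.univ.image p) (Finset.univ.image d) (τ.selected d)) ∧
          ((¬ ∃ S, IsCover (Finset.univ.image p) (Finset.univ.image d) S) → τ.saysNo) := by
  refine ⟨867, fun k hk => ?_⟩
  set K := ⌈k⌉₊
  set L := 8 * (2 * K + 2) ^ 2 with hL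
  refine ⟨solver K L, ((K + L + 1) * 1500 : ℕ) * 2 * 2 ^ (3 * (L + 1)), ?_⟩
  rintro n m p d hp hd ⟨z, hz⟩
  obtain ⟨τ, t, hrun, ht, hyes, hno⟩ := solver_spec (hasInput_inputState p d)
    (by simp [inputState]) (fun _ _ => rfl) (fitsIn_ofInput p d (Nat.le_ceil k) hz) hL.ge
  rw [exists_isCover_iff hd]
  refine ⟨τ, t, hrun, (Nat.cast_le.2 ht).trans (time_le_rpow (exponent_le hk)),
    fun hcover => ⟨(hyes hcover).1, ?_⟩, hno⟩
  rw [← corners_selectedIndices]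
  exact isOptimal_corners hp hd (hyes hcover).2
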